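/- Setting. Let $\mathcal X\subseteq\mathbb R^n$ and $\mathcal Y\subseteq\mathbb R^d$ be nonempty closed convex sets with $\mathcal X$ compact, and let $f:\mathbb R^n\times\mathbb R^d\to\mathbb R$ be continuously differentiable with $$\|\nabla_x f(x,y)-\nabla_x f(x',y')\|\le L(\|x-x'\|+\|y-y'\|),\qquad \|\nabla_y f(x,y)-\nabla_y f(x',y')\|\le L(\|x-x'\|+\|y-y'\|)$$ for all $x,x'\in\mathcal X$, $y,y'\in\mathcal Y$, where $L>0$. A pair $(x,y)\in\mathcal X\times\mathcal Y$ is an $\epsilon$-game-stationary point ($\epsilon$-GS) of $\min_{x\in\mathcal X}\max_{y\in\mathcal Y}f(x,y)$ if $$\operatorname{dist}(0,\nabla_x f(x,y)+\partial\iota_{\mathcal X}(x))\le\epsilon\quad\text{and}\quad\operatorname{dist}(0,-\nabla_y f(x,y)+\partial\iota_{\mathcal Y}(y))\le\epsilon,$$ where $\partial\iota$ denotes the normal cone. Algorithm (DS-OGDA). For parameters $r_x,r_y,\eta_x,\eta_y>0$ and $\beta_x,\beta_y\in(0,1)$ let $F(x,y,z,v)=f(x,y)+\frac{r_x}{2}\|x-z\|^2-\frac{r_y}{2}\|y-v\|^2$,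 and let $G_x^t=\nabla_xF$ and $G_y^t=-\nabla_yF$ be evaluated at $(x^t,y^t,z^t,v^t)$. Given $x^0\in\mathcal X$, $y^0\in\mathcal Y$, put $x^{-1}=z^{-1}=z^0=x^0$ and $y^{-1}=v^{-1}=v^0=y^0$, and for $t=0,1,2,\dots$ $$x^{t+1}=\mathrm{proj}_{\mathcal X}\big(x^t-\eta_xG_x^t+\eta_x(G_x^{t-1}-G_x^t)\big),\qquad y^{t+1}=\mathrm{proj}_{\mathcal Y}\big(y^t-\eta_yG_y^t+\eta_y(G_y^{t-1}-G_y^t)\big),$$ $$z^{t+1}=z^t+\beta_x(x^t-z^t),\qquad v^{t+1}=v^t+\beta_y(y^t-v^t).$$ Statement. For every integer $T>1$ one can select parameters $r_x,r_y,\eta_x,\eta_y>0$ and $\beta_x,\beta_y\in(0,1)$, all of them $\mathcal O(1)$ as $T$ varies, such that the following hold. (i) (Convex primal.) The parameters depend only on $L$ and $T$, and $\beta_y\le\mathcal O(T^{-1/2})$. If $f(\cdot,y)$ is convex on $\mathbb R^n$ for every $y\in\mathcal Y$, and $y\mapsto\min_{x\in\mathcal X}f(x,y)$ is bounded above on $\mathcal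 Y$, then for all $x^0\in\mathcal X$ and $y^0\in\mathcal Y$ and every $T>1$ there is $t\in\{0,\dots,T-1\}$ such that $(x^{t+1},y^{t+1})$ is an $\mathcal O(T^{-1/4})$-GS. (ii) (Kurdyka-Łojasiewicz primal.) Let $\mathcal Y$ be compact and let $D$ be an upper bound for the diameters of $\mathcal X$ and $\mathcal Y$. Suppose that for every $y\in\mathcal Y$ the problem $\min_{x\in\mathcal X}f(x,y)$ has a solution, and that for some $\tau>0$, $\theta\in(0,1)$ $$\Big(f(x,y)-\min_{x'\in\mathcal X}f(x',y)\Big)^{\theta}\le\frac1\tau\operatorname{dist}(0,\nabla_xf(x,y)+\partial\iota_{\mathcal X}(x))\qquad\text{for all }x\in\mathcal X,\ y\in\mathcal Y.$$ The parameters (a separate choice from (i)) depend only on $L,\tau,\theta,D$ and $T$, and $\beta_y\le\mathcal O(T^{-(2\theta-1)_+/(2\theta)})$. Then for all $x^0\in\mathcal X$ and $y^0\in\mathcal Y$ and every $T>1$ there is $t\in\{0,\dots,T-1\}$ such that $(x^{t+1},y^{t+1})$ is an $\mathcal O\big(T^{-1/((4\theta-2)_++2)}\big)$-GS. Here the constants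 in the bounds on the parameters depend only on $L$ in (i) and only on $L,\tau,\theta,D$ in (ii); the constants in the stationarity rates may depend on the problem $(f,\mathcal X,\mathcal Y)$ and on $(x^0,y^0)$, but not on $T$. -/

import Mathlib

open scoped RealInnerProductSpace

noncomputable section

/-- Normal cone of `K` at `p`, that is, the subdifferential at `p ∈ K` of the indicator function
of a convex set `K`. -/
def indicatorSubdifferential {n : ℕ} (K : Set (EuclideanSpace ℝ (Fin n)))
    (p : EuclideanSpace ℝ (Fin n)) : Set (EuclideanSpace ℝ (Fin n)) :=
  {g | ∀ q ∈ K, ⟪g, q - p⟫ ≤ 0}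

/-- A nearest point of `K` to `p`; it exists and is unique when `K` is nonempty, closed and
convex. -/
def projOnto {n : ℕ} (K : Set (EuclideanSpace ℝ (Fin n)))
    (p : EuclideanSpace ℝ (Fin n)) : EuclideanSpace ℝ (Fin n) :=
  Classical.epsilon fun q => q ∈ K ∧ ∀ w ∈ K, ‖p - q‖ ≤ ‖p - w‖

/-- Partial gradient with respect to the first variable. -/
def gradX {n d : ℕ} (f : EuclideanSpace ℝ (Fin n) → EuclideanSpace ℝ (Fin d) → ℝ)
    (x : EuclideanSpace ℝ (Fin n)) (y : EuclideanSpace ℝ (Fin d)) : EuclideanSpace ℝ (Fin n) :=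
  gradient (fun x' => f x' y) x

/-- Partial gradient with respect to the second variable. -/
def gradY {n d : ℕ} (f : EuclideanSpace ℝ (Fin n) → EuclideanSpace ℝ (Fin d) → ℝ)
    (x : EuclideanSpace ℝ (Fin n)) (y : EuclideanSpace ℝ (Fin d)) : EuclideanSpace ℝ (Fin d) :=
  gradient (fun y' => f x y') y

/-- `f` is continuously differentiable and its partial gradients are `L`-Lipschitz on `X × Y`. -/
def SmoothObjective {n d : ℕ} (f : EuclideanSpace ℝ (Fin n) → EuclideanSpace ℝ (Fin d) → ℝ)
    (X : Set (EuclideanSpace ℝ (Fin n))) (Y : Set (EuclideanSpace ℝ (Fin d))) (L : ℝ) : Prop :=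
  ContDiff ℝ 1 (fun u : EuclideanSpace ℝ (Fin n) × EuclideanSpace ℝ (Fin d) => f u.1 u.2) ∧
  ∀ x ∈ X, ∀ x' ∈ X, ∀ y ∈ Y, ∀ y' ∈ Y,
    ‖gradX f x y - gradX f x' y'‖ ≤ L * (‖x - x'‖ + ‖y - y'‖) ∧
    ‖gradY f x y - gradY f x' y'‖ ≤ L * (‖x - x'‖ + ‖y - y'‖)

/-- The value `min_{x ∈ X} f(x, y)` of the primal problem. -/
def primalMin {n d : ℕ} (f : EuclideanSpace ℝ (Fin n) → EuclideanSpace ℝ (Fin d) → ℝ)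
    (X : Set (EuclideanSpace ℝ (Fin n))) (y : EuclideanSpace ℝ (Fin d)) : ℝ :=
  sInf ((fun x => f x y) '' X)

/-- `dist(0, ∇ₓ f(x, y) + ∂ι_X(x))`. -/
def primalResidual {n d : ℕ} (f : EuclideanSpace ℝ (Fin n) → EuclideanSpace ℝ (Fin d) → ℝ)
    (X : Set (EuclideanSpace ℝ (Fin n)))
    (x : EuclideanSpace ℝ (Fin n)) (y : EuclideanSpace ℝ (Fin d)) : ℝ :=
  Metric.infDist 0 ((fun g => gradX f x y + g) '' indicatorSubdifferential X x)

/-- `dist(0, -∇_y f(x, y) + ∂ι_Y(y))`. -/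
def dualResidual {n d : ℕ} (f : EuclideanSpace ℝ (Fin n) → EuclideanSpace ℝ (Fin d) → ℝ)
    (Y : Set (EuclideanSpace ℝ (Fin d)))
    (x : EuclideanSpace ℝ (Fin n)) (y : EuclideanSpace ℝ (Fin d)) : ℝ :=
  Metric.infDist 0 ((fun g => -gradY f x y + g) '' indicatorSubdifferential Y y)

/-- `(x, y)` is an `ε`-game-stationary point. -/
def IsGameStationary {n d : ℕ} (f : EuclideanSpace ℝ (Fin n) → EuclideanSpace ℝ (Fin d) → ℝ)
    (X : Set (EuclideanSpace ℝ (Fin n))) (Y : Set (EuclideanSpace ℝ (Fin d))) (ε : ℝ)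
    (x : EuclideanSpace ℝ (Fin n)) (y : EuclideanSpace ℝ (Fin d)) : Prop :=
  x ∈ X ∧ y ∈ Y ∧ primalResidual f X x y ≤ ε ∧ dualResidual f Y x y ≤ ε

/-- The Kurdyka-Łojasiewicz property of the primal problem, with exponent `θ` and constant `τ`,
uniformly in `y ∈ Y`. -/
def PrimalKL {n d : ℕ} (f : EuclideanSpace ℝ (Fin n) → EuclideanSpace ℝ (Fin d) → ℝ)
    (X : Set (EuclideanSpace ℝ (Fin n))) (Y : Set (EuclideanSpace ℝ (Fin d))) (τ θ : ℝ) : Prop :=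
  (∀ y ∈ Y, ∃ xs ∈ X, IsMinOn (fun x => f x y) X xs) ∧
  ∀ x ∈ X, ∀ y ∈ Y, (f x y - primalMin f X y) ^ θ ≤ 1 / τ * primalResidual f X x y

/-- The parameters of DS-OGDA. -/
structure Params where
  rx : ℝ
  ry : ℝ
  ηx : ℝ
  ηy : ℝ
  βx : ℝ
  βy : ℝ

/-- All parameters are positive and at most `C`, and the smoothing parameters are below `1`. -/
def Params.Admissible (P : Params) (C : ℝ) : Prop :=
  (0 < P.rx ∧ P.rx ≤ C) ∧ (0 < P.ry ∧ P.ry ≤ C) ∧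
  (0 < P.ηx ∧ P.ηx ≤ C) ∧ (0 < P.ηy ∧ P.ηy ≤ C) ∧
  (0 < P.βx ∧ P.βx ≤ C ∧ P.βx < 1) ∧ (0 < P.βy ∧ P.βy ≤ C ∧ P.βy < 1)

/-- The variables `u = (x, y, z, v)` of the algorithm. -/
structure Iterate (n d : ℕ) where
  x : EuclideanSpace ℝ (Fin n)
  y : EuclideanSpace ℝ (Fin d)
  z : EuclideanSpace ℝ (Fin n)
  v : EuclideanSpace ℝ (Fin d)

/-- The regularized function `F(x, y, z, v)`. -/
def regularized {n d : ℕ} (f : EuclideanSpace ℝ (Fin n) → EuclideanSpace ℝ (Fin d) → ℝ)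
    (P : Params) (x : EuclideanSpace ℝ (Fin n)) (y : EuclideanSpace ℝ (Fin d))
    (z : EuclideanSpace ℝ (Fin n)) (v : EuclideanSpace ℝ (Fin d)) : ℝ :=
  f x y + P.rx / 2 * ‖x - z‖ ^ 2 - P.ry / 2 * ‖y - v‖ ^ 2

/-- The block `G_x = ∇ₓ F`. -/
def Gx {n d : ℕ} (f : EuclideanSpace ℝ (Fin n) → EuclideanSpace ℝ (Fin d) → ℝ)
    (P : Params) (u : Iterate n d) : EuclideanSpace ℝ (Fin n) :=
  gradient (fun x' => regularized f P x' u.y u.z u.v) u.x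

/-- The block `G_y = -∇_y F`. -/
def Gy {n d : ℕ} (f : EuclideanSpace ℝ (Fin n) → EuclideanSpace ℝ (Fin d) → ℝ)
    (P : Params) (u : Iterate n d) : EuclideanSpace ℝ (Fin d) :=
  -gradient (fun y' => regularized f P u.x y' u.z u.v) u.y

/-- One step of DS-OGDA: `u` is the current iterate and `w` the previous one. -/
def dsogdaStep {n d : ℕ} (f : EuclideanSpace ℝ (Fin n) → EuclideanSpace ℝ (Fin d) → ℝ)
    (X : Set (EuclideanSpace ℝ (Fin n))) (Y : Set (EuclideanSpace ℝ (Fin d)))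
    (P : Params) (w u : Iterate n d) : Iterate n d where
  x := projOnto X (u.x - P.ηx • Gx f P u + P.ηx • (Gx f P w - Gx f P u))
  y := projOnto Y (u.y - P.ηy • Gy f P u + P.ηy • (Gy f P w - Gy f P u))
  z := u.z + P.βx • (u.x - u.z)
  v := u.v + P.βy • (u.y - u.v)

/-- The pair (iterate `t - 1`, iterate `t`), started at `x⁻¹ = z⁻¹ = z⁰ = x⁰` and
`y⁻¹ = v⁻¹ = v⁰ = y⁰`. -/
def dsogdaPair {n d : ℕ} (f : EuclideanSpace ℝ (Fin n) → EuclideanSpace ℝ (Fin d) → ℝ)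
    (X : Set (EuclideanSpace ℝ (Fin n))) (Y : Set (EuclideanSpace ℝ (Fin d)))
    (P : Params) (x₀ : EuclideanSpace ℝ (Fin n)) (y₀ : EuclideanSpace ℝ (Fin d)) :
    ℕ → Iterate n d × Iterate n d
  | 0 => (⟨x₀, y₀, x₀, y₀⟩, ⟨x₀, y₀, x₀, y₀⟩)
  | t + 1 =>
    ((dsogdaPair f X Y P x₀ y₀ t).2,
      dsogdaStep f X Y P (dsogdaPair f X Y P x₀ y₀ t).1 (dsogdaPair f X Y P x₀ y₀ t).2)

/-- The iterate `u^t = (x^t, y^t, z^t, v^t)` of DS-OGDA. -/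
def dsogda {n d : ℕ} (f : EuclideanSpace ℝ (Fin n) → EuclideanSpace ℝ (Fin d) → ℝ)
    (X : Set (EuclideanSpace ℝ (Fin n))) (Y : Set (EuclideanSpace ℝ (Fin d)))
    (P : Params) (x₀ : EuclideanSpace ℝ (Fin n)) (y₀ : EuclideanSpace ℝ (Fin d)) (t : ℕ) :
    Iterate n d :=
  (dsogdaPair f X Y P x₀ y₀ t).2

end

/-! With r_y = 2L the regularized dual problem is L-strongly concave, so Φ(x,v) = max_Y (f(x,·) −
L‖· − v‖²) has a unique maximizer b(x,v), Lipschitz in (x,v). Let e(v) be the same maximum with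
f(x,·) replaced by the primal value min_X f(·,y); then e ≤ Φ, and e is bounded above. The proof
follows the potential Φ(x,v) − 2e(v) plus L times weighted squares of the last displacements, of y −
b and of x − z. It is bounded below because Φ − 2e ≥ −e.

Moving v by β_y(y − v) changes Φ by at most about 2Lβ_y‖y − v‖² and increases e by at least about
the same amount, so the coefficient 2 leaves a net decrease. The error is the distance between b and
the maximizer defining e, and the square of that distance is at most (2/L)(Φ − e). The other squares
are handled by small steps: x moves much more slowly than y, and y contracts towards b. Hence
`lyapunov_step`: the potential drops by L times the movement S plus (L/4)β_y‖y − v‖², up to 16β_y(Φ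
− e).

The gap Φ − e is at most the primal gap of f(·,b) at the new x. The projection step shows that the
primal residual there is O(√S), so an error bound with exponent θ gives (Φ − e)^θ = O(√S)
(`gap_rpow_le`). A convex problem on a compact set has such a bound with θ = 1. If θ ≤ 1/2,
boundedness of S gives Φ − e = O(S), absorbed for a small constant β_y. If θ > 1/2, absorption
leaves O(β_y^{2θ/(2θ−1)}), which is O(1/T) when β_y is of order T^{1/(2θ)−1}.

Averaging over T steps yields S = O(1/T) and ‖y − v‖² = O(1/(Tβ_y)). Both residuals are O(√S + ‖y −
v‖), which gives the rates. -/

noncomputable section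

/-! ### Gradient inequalities in inner product spaces -/

section GeneralAnalysis

variable {E : Type*} [NormedAddCommGroup E] [InnerProductSpace ℝ E] [CompleteSpace E]

theorem hasDerivAt_lineMap_of_hasGradientAt {g : E → ℝ} {g' : E → E}
    (hg : ∀ x, HasGradientAt g (g' x) x) (x h : E) (t : ℝ) :
    HasDerivAt (fun s : ℝ => g (x + s • h)) ⟪g' (x + t • h), h⟫ t := by
  have h1 : HasDerivAt (fun s : ℝ => x + s • h) h t := by
    simpa using ((hasDerivAt_id t).smul_const h).const_add x
  have h2 := (hg (x + t • h)).hasFDerivAt.comp_hasDerivAt t h1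
  simpa [Function.comp_def] using h2

/-- Quadratic upper bound for a function with Lipschitz gradient on a convex set. -/
theorem le_add_inner_gradient_add_sq {g : E → ℝ} {g' : E → E} {K : Set E} {L : ℝ}
    (hg : ∀ x, HasGradientAt g (g' x) x) (hK : Convex ℝ K)
    (hL : ∀ x ∈ K, ∀ y ∈ K, ‖g' x - g' y‖ ≤ L * ‖x - y‖) {x y : E} (hx : x ∈ K) (hy : y ∈ K) :
    g y ≤ g x + ⟪g' x, y - x⟫ + L / 2 * ‖y - x‖ ^ 2 := by
  set h := y - x with hh
  have hd : ∀ t : ℝ, HasDerivAt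
      (fun s : ℝ => g (x + s • h) - s * ⟪g' x, h⟫ - L / 2 * ‖h‖ ^ 2 * s ^ 2)
      (⟪g' (x + t • h), h⟫ - ⟪g' x, h⟫ - L * ‖h‖ ^ 2 * t) t := by
    intro t
    have h1 := hasDerivAt_lineMap_of_hasGradientAt hg x h t
    have h2 : HasDerivAt (fun s : ℝ => s * ⟪g' x, h⟫) ⟪g' x, h⟫ t := by
      simpa using (hasDerivAt_id t).mul_const ⟪g' x, h⟫
    have h3 : HasDerivAt (fun s : ℝ => L / 2 * ‖h‖ ^ 2 * s ^ 2) (L * ‖h‖ ^ 2 * t) t := by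
      exact ((hasDerivAt_pow 2 t).const_mul (L / 2 * ‖h‖ ^ 2)).congr_deriv (by norm_num; ring)
    exact (h1.sub h2).sub h3
  have hanti : AntitoneOn
      (fun s : ℝ => g (x + s • h) - s * ⟪g' x, h⟫ - L / 2 * ‖h‖ ^ 2 * s ^ 2) (Set.Icc 0 1) := by
    refine antitoneOn_of_deriv_nonpos (convex_Icc 0 1)
      (fun t _ => (hd t).continuousAt.continuousWithinAt)
      (fun t _ => (hd t).differentiableAt.differentiableWithinAt) fun t ht => ?_
    rw [interior_Icc] at ht
    rw [(hd t).deriv, ← inner_sub_left]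
    have hmem : x + t • h ∈ K := hK.add_smul_sub_mem hx hy ⟨ht.1.le, ht.2.le⟩
    have h1 := hL _ hmem _ hx
    rw [add_sub_cancel_left, norm_smul, Real.norm_of_nonneg ht.1.le] at h1
    have h2 := real_inner_le_norm (g' (x + t • h) - g' x) h
    nlinarith [mul_le_mul_of_nonneg_right h1 (norm_nonneg h)]
  have := hanti (Set.left_mem_Icc.2 zero_le_one) (Set.right_mem_Icc.2 zero_le_one) zero_le_one
  simp only [one_smul, zero_smul, add_zero] at this
  have hxy : x + h = y := by rw [hh]; abel
  rw [hxy] at this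
  linarith

/-- First-order optimality for maximization over a convex set. -/
theorem inner_gradient_nonpos_of_isMaxOn {g : E → ℝ} {g' : E} {K : Set E} {x y : E}
    (hg : HasGradientAt g g' x) (hK : Convex ℝ K) (hx : x ∈ K) (hy : y ∈ K)
    (hmax : ∀ q ∈ K, g q ≤ g x) : ⟪g', y - x⟫ ≤ 0 := by
  have h1 : IsLocalMaxOn g K x := IsMaxOn.localize (fun q hq => hmax q hq)
  have h2 := h1.hasFDerivWithinAt_nonpos hg.hasFDerivAt.hasFDerivWithinAt
    (sub_mem_posTangentConeAt_of_segment_subset (hK.segment_subset hx hy))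
  simpa using h2

/-- The gradient inequality for convex functions. -/
theorem ConvexOn.inner_gradient_le {g : E → ℝ} {g' : E → E}
    (hg : ∀ x, HasGradientAt g (g' x) x) (hc : ConvexOn ℝ Set.univ g) (x y : E) :
    ⟪g' x, y - x⟫ ≤ g y - g x := by
  have h1 : ConvexOn ℝ Set.univ (fun s : ℝ => g (x + s • (y - x))) := by
    have := hc.comp_affineMap (AffineMap.lineMap x y : ℝ →ᵃ[ℝ] E)
    rw [Set.preimage_univ] at this
    refine this.congr fun s _ => ?_
    simp [AffineMap.lineMap_apply, add_comm]
  have h2 := hasDerivAt_lineMap_of_hasGradientAt hg x (y - x) 0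
  have h3 := h1.le_slope_of_hasDerivAt (Set.mem_univ 0) (Set.mem_univ 1) zero_lt_one h2
  simpa [slope_def_field] using h3

end GeneralAnalysis

/-! ### Existence and comparison of proximal maxima -/

section ProximalMaximum

variable {E : Type*} [NormedAddCommGroup E]

/-- A maximizer over `K` of the proximally regularized function. -/
def regArgmax (φ : E → ℝ) (K : Set E) (r : ℝ) (v : E) : E :=
  Classical.epsilon fun y => y ∈ K ∧ ∀ q ∈ K, φ q - r / 2 * ‖q - v‖ ^ 2 ≤ φ y - r / 2 * ‖y - v‖ ^ 2

/-- The maximum over `K` of the proximally regularized function. -/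
def regMax (φ : E → ℝ) (K : Set E) (r : ℝ) (v : E) : ℝ :=
  φ (regArgmax φ K r v) - r / 2 * ‖regArgmax φ K r v - v‖ ^ 2

/-- Growth with quadratic coefficient ℓ/2 < r/2 is beaten by the penalty far from v, so the
maximization reduces to a ball. This replaces compactness of K, which is not available for the dual
set in the convex case. -/
theorem regArgmax_spec [ProperSpace E] {φ : E → ℝ} {K : Set E} {r ℓ c₀ c₁ : ℝ} {v : E}
    (hφ : ContinuousOn φ K) (hK : IsClosed K) (hv : v ∈ K) (hr : ℓ < r)
    (hgrow : ∀ q ∈ K, φ q ≤ c₀ + c₁ * ‖q - v‖ + ℓ / 2 * ‖q - v‖ ^ 2) :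
    regArgmax φ K r v ∈ K ∧ ∀ q ∈ K, φ q - r / 2 * ‖q - v‖ ^ 2 ≤ regMax φ K r v := by
  refine Classical.epsilon_spec
    (p := fun y => y ∈ K ∧ ∀ q ∈ K, φ q - r / 2 * ‖q - v‖ ^ 2 ≤ φ y - r / 2 * ‖y - v‖ ^ 2) ?_
  set c := |c₀ - φ v| + |c₁| with hc
  -- For ρ ≥ R, R ≥ 1 lets c·ρ dominate the constant and linear terms, and R ≥ 2c/(r − ℓ) gives c·ρ
  -- ≤ (r − ℓ)/2·ρ².
  set R := max 1 (2 * c / (r - ℓ)) with hR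
  have hR1 : (1 : ℝ) ≤ R := le_max_left _ _
  have hR2 : 2 * c / (r - ℓ) ≤ R := le_max_right _ _
  have hvb : v ∈ K ∩ Metric.closedBall v R := ⟨hv, Metric.mem_closedBall_self (by linarith)⟩
  have hcomp : IsCompact (K ∩ Metric.closedBall v R) := (isCompact_closedBall v R).inter_left hK
  have hcont : ContinuousOn (fun q => φ q - r / 2 * ‖q - v‖ ^ 2) (K ∩ Metric.closedBall v R) :=
    (hφ.mono Set.inter_subset_left).sub (by fun_prop)
  obtain ⟨y, hy, hmax⟩ := hcomp.exists_isMaxOn ⟨v, hvb⟩ hcont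
  refine ⟨y, hy.1, fun q hq => ?_⟩
  by_cases hqb : ‖q - v‖ ≤ R
  · exact hmax ⟨hq, by simpa [dist_eq_norm] using hqb⟩
  · push Not at hqb
    have h1 := hmax hvb
    simp only [Set.mem_ofPred_eq, sub_self, norm_zero] at h1
    have h2 := hgrow q hq
    set ρ := ‖q - v‖
    have hρ : 1 ≤ ρ := hR1.trans hqb.le
    have hrl : 0 < r - ℓ := sub_pos.2 hr
    have h3 : 2 * c ≤ R * (r - ℓ) := (div_le_iff₀ hrl).1 hR2
    have h4 : c₀ - φ v ≤ |c₀ - φ v| * ρ := (le_abs_self _).trans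
      (le_mul_of_one_le_right (abs_nonneg _) hρ)
    have h5 : c₁ * ρ ≤ |c₁| * ρ := mul_le_mul_of_nonneg_right (le_abs_self _) (by linarith)
    have h6 : c * ρ ≤ (r - ℓ) / 2 * ρ ^ 2 := by
      have : R * (r - ℓ) ≤ ρ * (r - ℓ) := mul_le_mul_of_nonneg_right hqb.le hrl.le
      nlinarith
    have h7 : c * ρ = |c₀ - φ v| * ρ + |c₁| * ρ := by rw [hc]; ring
    nlinarith

/-- The maximizer for v is a competitor for v'. This one-sided envelope estimate serves as an upper
bound for Φ and, with the roles of the centers exchanged, as a lower bound for e. -/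
theorem regMax_sub_le {φ : E → ℝ} {K : Set E} {r : ℝ} {v v' : E}
    (hv : regArgmax φ K r v ∈ K) (hv' : ∀ q ∈ K, φ q - r / 2 * ‖q - v'‖ ^ 2 ≤ regMax φ K r v') :
    regMax φ K r v ≤ regMax φ K r v' -
      r / 2 * (‖regArgmax φ K r v - v‖ ^ 2 - ‖regArgmax φ K r v - v'‖ ^ 2) := by
  have := hv' _ hv
  simp only [regMax] at this ⊢
  linarith

end ProximalMaximum

/-! ### Projection, standing assumptions and value functions -/

theorem projOnto_spec {n : ℕ} {K : Set (EuclideanSpace ℝ (Fin n))} (hne : K.Nonempty)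
    (hcl : IsClosed K) (hK : Convex ℝ K) (p : EuclideanSpace ℝ (Fin n)) :
    projOnto K p ∈ K ∧ ∀ w ∈ K, ⟪p - projOnto K p, w - projOnto K p⟫ ≤ 0 := by
  have hbdd : BddBelow (Set.range fun w : K => ‖p - w‖) :=
    ⟨0, by rintro _ ⟨w, rfl⟩; exact norm_nonneg _⟩
  have h : projOnto K p ∈ K ∧ ∀ w ∈ K, ‖p - projOnto K p‖ ≤ ‖p - w‖ := by
    refine Classical.epsilon_spec (p := fun q => q ∈ K ∧ ∀ w ∈ K, ‖p - q‖ ≤ ‖p - w‖) ?_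
    obtain ⟨q, hq, hq'⟩ := exists_norm_eq_iInf_of_complete_convex hne hcl.isComplete hK p
    exact ⟨q, hq, fun w hw => hq' ▸ ciInf_le hbdd ⟨w, hw⟩⟩
  refine ⟨h.1, (norm_eq_iInf_iff_real_inner_le_zero hK h.1).1 (le_antisymm ?_ ?_)⟩
  · have : Nonempty K := hne.to_subtype
    exact le_ciInf fun w => h.2 w w.2
  · exact ciInf_le hbdd ⟨_, h.1⟩

/-- The standing assumptions on the minimax problem; the primal value is bounded above on `Y`. -/
structure MinimaxProblem {n d : ℕ}
    (f : EuclideanSpace ℝ (Fin n) → EuclideanSpace ℝ (Fin d) → ℝ)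
    (X : Set (EuclideanSpace ℝ (Fin n))) (Y : Set (EuclideanSpace ℝ (Fin d))) (L : ℝ) :
    Prop where
  pos : 0 < L
  compactX : IsCompact X
  convexX : Convex ℝ X
  nonemptyX : X.Nonempty
  closedY : IsClosed Y
  convexY : Convex ℝ Y
  smooth : SmoothObjective f X Y L
  bddAbove : BddAbove (primalMin f X '' Y)

/-- The maximizer over `Y` of `f(x, ·) - L‖· - v‖²`. -/
def bestResponse {n d : ℕ} (f : EuclideanSpace ℝ (Fin n) → EuclideanSpace ℝ (Fin d) → ℝ)
    (Y : Set (EuclideanSpace ℝ (Fin d))) (L : ℝ) (x : EuclideanSpace ℝ (Fin n))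
    (v : EuclideanSpace ℝ (Fin d)) : EuclideanSpace ℝ (Fin d) :=
  regArgmax (f x) Y (2 * L) v

/-- The maximum over `Y` of `f(x, ·) - L‖· - v‖²`. -/
def smoothedMax {n d : ℕ} (f : EuclideanSpace ℝ (Fin n) → EuclideanSpace ℝ (Fin d) → ℝ)
    (Y : Set (EuclideanSpace ℝ (Fin d))) (L : ℝ) (x : EuclideanSpace ℝ (Fin n))
    (v : EuclideanSpace ℝ (Fin d)) : ℝ :=
  regMax (f x) Y (2 * L) v

/-- The proximal point of `v` for the primal value. -/
def proxPoint {n d : ℕ} (f : EuclideanSpace ℝ (Fin n) → EuclideanSpace ℝ (Fin d) → ℝ)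
    (X : Set (EuclideanSpace ℝ (Fin n))) (Y : Set (EuclideanSpace ℝ (Fin d))) (L : ℝ)
    (v : EuclideanSpace ℝ (Fin d)) : EuclideanSpace ℝ (Fin d) :=
  regArgmax (primalMin f X) Y (2 * L) v

/-- The Moreau envelope of the primal value. -/
def envelope {n d : ℕ} (f : EuclideanSpace ℝ (Fin n) → EuclideanSpace ℝ (Fin d) → ℝ)
    (X : Set (EuclideanSpace ℝ (Fin n))) (Y : Set (EuclideanSpace ℝ (Fin d))) (L : ℝ)
    (v : EuclideanSpace ℝ (Fin d)) : ℝ :=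
  regMax (primalMin f X) Y (2 * L) v

theorem hasGradientAt_half_mul_norm_sub_sq {E : Type*} [NormedAddCommGroup E]
    [InnerProductSpace ℝ E] [CompleteSpace E] (r : ℝ) (c x : E) :
    HasGradientAt (fun q => r / 2 * ‖q - c‖ ^ 2) (r • (x - c)) x := by
  rw [hasGradientAt_iff_hasFDerivAt]
  have h := (((hasFDerivAt_id x).sub_const c).norm_sq).const_mul (r / 2)
  refine h.congr_fderiv ?_
  ext w
  simp only [smul_apply, ContinuousLinearMap.comp_apply, innerSL_apply_apply,
    InnerProductSpace.toDual_apply_apply, inner_smul_left, smul_eq_mul, nsmul_eq_mul, id]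
  simp
  ring

/-! ### Regularity of the smoothed maximum and of the Moreau envelope -/

namespace MinimaxProblem

variable {n d : ℕ} {f : EuclideanSpace ℝ (Fin n) → EuclideanSpace ℝ (Fin d) → ℝ}
  {X : Set (EuclideanSpace ℝ (Fin n))} {Y : Set (EuclideanSpace ℝ (Fin d))} {L : ℝ}

theorem continuous (h : MinimaxProblem f X Y L) :
    Continuous fun u : EuclideanSpace ℝ (Fin n) × EuclideanSpace ℝ (Fin d) => f u.1 u.2 :=
  h.smooth.1.continuous

theorem hasGradientAt_fst (h : MinimaxProblem f X Y L) (x : EuclideanSpace ℝ (Fin n))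
    (y : EuclideanSpace ℝ (Fin d)) : HasGradientAt (fun x' => f x' y) (gradX f x y) x := by
  have h1 : Differentiable ℝ
      (fun u : EuclideanSpace ℝ (Fin n) × EuclideanSpace ℝ (Fin d) => f u.1 u.2) :=
    h.smooth.1.differentiable one_ne_zero
  have h2 : Differentiable ℝ (fun x' => f x' y) :=
    h1.comp (differentiable_id.prodMk (differentiable_const y))
  exact (h2 x).hasGradientAt

theorem hasGradientAt_snd (h : MinimaxProblem f X Y L) (x : EuclideanSpace ℝ (Fin n))
    (y : EuclideanSpace ℝ (Fin d)) : HasGradientAt (f x) (gradY f x y) y := by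
  have h1 : Differentiable ℝ
      (fun u : EuclideanSpace ℝ (Fin n) × EuclideanSpace ℝ (Fin d) => f u.1 u.2) :=
    h.smooth.1.differentiable one_ne_zero
  have h2 : Differentiable ℝ (fun y' => f x y') :=
    h1.comp ((differentiable_const x).prodMk differentiable_id)
  exact (h2 y).hasGradientAt

theorem Gx_eq (h : MinimaxProblem f X Y L) (P : Params) (u : Iterate n d) :
    Gx f P u = gradX f u.x u.y + P.rx • (u.x - u.z) := by
  refine HasGradientAt.gradient ?_
  have h1 := (h.hasGradientAt_fst u.x u.y).hasFDerivAt.add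
    (hasGradientAt_half_mul_norm_sub_sq P.rx u.z u.x).hasFDerivAt
  rw [hasGradientAt_iff_hasFDerivAt, map_add]
  exact h1.sub_const _

theorem Gy_eq (h : MinimaxProblem f X Y L) (P : Params) (u : Iterate n d) :
    Gy f P u = -gradY f u.x u.y + P.ry • (u.y - u.v) := by
  have : gradient (fun y' => regularized f P u.x y' u.z u.v) u.y =
      gradY f u.x u.y - P.ry • (u.y - u.v) := by
    refine HasGradientAt.gradient ?_
    have h1 := ((h.hasGradientAt_snd u.x u.y).hasFDerivAt.add_const
      (P.rx / 2 * ‖u.x - u.z‖ ^ 2)).sub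
      (hasGradientAt_half_mul_norm_sub_sq P.ry u.v u.y).hasFDerivAt
    rw [hasGradientAt_iff_hasFDerivAt, map_sub]
    exact h1
  rw [Gy, this]
  abel

theorem gradX_lipschitz (h : MinimaxProblem f X Y L) {x x' : EuclideanSpace ℝ (Fin n)}
    {y y' : EuclideanSpace ℝ (Fin d)} (hx : x ∈ X) (hx' : x' ∈ X) (hy : y ∈ Y) (hy' : y' ∈ Y) :
    ‖gradX f x y - gradX f x' y'‖ ≤ L * (‖x - x'‖ + ‖y - y'‖) :=
  (h.smooth.2 x hx x' hx' y hy y' hy').1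

theorem gradY_lipschitz (h : MinimaxProblem f X Y L) {x x' : EuclideanSpace ℝ (Fin n)}
    {y y' : EuclideanSpace ℝ (Fin d)} (hx : x ∈ X) (hx' : x' ∈ X) (hy : y ∈ Y) (hy' : y' ∈ Y) :
    ‖gradY f x y - gradY f x' y'‖ ≤ L * (‖x - x'‖ + ‖y - y'‖) :=
  (h.smooth.2 x hx x' hx' y hy y' hy').2

theorem le_quadratic_fst (h : MinimaxProblem f X Y L) {x x' : EuclideanSpace ℝ (Fin n)}
    {y : EuclideanSpace ℝ (Fin d)} (hx : x ∈ X) (hx' : x' ∈ X) (hy : y ∈ Y) :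
    f x' y ≤ f x y + ⟪gradX f x y, x' - x⟫ + L / 2 * ‖x' - x‖ ^ 2 :=
  le_add_inner_gradient_add_sq (g := fun x => f x y) (fun x => h.hasGradientAt_fst x y) h.convexX
    (fun x hx x' hx' => by simpa using h.gradX_lipschitz hx hx' hy hy) hx hx'

theorem le_quadratic_snd (h : MinimaxProblem f X Y L) {x : EuclideanSpace ℝ (Fin n)}
    {y y' : EuclideanSpace ℝ (Fin d)} (hx : x ∈ X) (hy : y ∈ Y) (hy' : y' ∈ Y) :
    f x y' ≤ f x y + ⟪gradY f x y, y' - y⟫ + L / 2 * ‖y' - y‖ ^ 2 :=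
  le_add_inner_gradient_add_sq (fun y => h.hasGradientAt_snd x y) h.convexY
    (fun y hy y' hy' => by simpa using h.gradY_lipschitz hx hx hy hy') hy hy'

theorem primalMin_le (h : MinimaxProblem f X Y L) {x : EuclideanSpace ℝ (Fin n)} (hx : x ∈ X)
    (y : EuclideanSpace ℝ (Fin d)) : primalMin f X y ≤ f x y := by
  have hc : Continuous fun x => f x y := h.continuous.comp (.prodMk_left y)
  exact csInf_le (h.compactX.bddBelow_image hc.continuousOn) ⟨x, hx, rfl⟩

theorem continuous_primalMin (h : MinimaxProblem f X Y L) : Continuous (primalMin f X) :=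
  h.compactX.continuous_sInf (f := fun y x => f x y)
    (h.continuous.comp continuous_swap)

theorem bestResponse_spec (h : MinimaxProblem f X Y L) {x : EuclideanSpace ℝ (Fin n)}
    {v : EuclideanSpace ℝ (Fin d)} (hx : x ∈ X) (hv : v ∈ Y) :
    bestResponse f Y L x v ∈ Y ∧
      ∀ q ∈ Y, f x q - 2 * L / 2 * ‖q - v‖ ^ 2 ≤ smoothedMax f Y L x v := by
  refine regArgmax_spec (ℓ := L) (c₀ := f x v) (c₁ := ‖gradY f x v‖) ?_ h.closedY hv
    (by linarith [h.pos]) fun q hq => ?_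
  · exact (h.continuous.comp (Continuous.prodMk_right x)).continuousOn
  · have h1 := h.le_quadratic_snd hx hv hq
    have h2 := real_inner_le_norm (gradY f x v) (q - v)
    linarith

theorem proxPoint_spec (h : MinimaxProblem f X Y L) {v : EuclideanSpace ℝ (Fin d)} (hv : v ∈ Y) :
    proxPoint f X Y L v ∈ Y ∧
      ∀ q ∈ Y, primalMin f X q - 2 * L / 2 * ‖q - v‖ ^ 2 ≤ envelope f X Y L v := by
  obtain ⟨M, hM⟩ := h.bddAbove
  -- Boundedness of the primal value makes its growth constant, so any positive penalty suffices.
  refine regArgmax_spec (ℓ := 0) (c₀ := M) (c₁ := 0) h.continuous_primalMin.continuousOn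
    h.closedY hv (by linarith [h.pos]) fun q hq => ?_
  have := hM ⟨q, hq, rfl⟩
  linarith

theorem bestResponse_mem (h : MinimaxProblem f X Y L) {x : EuclideanSpace ℝ (Fin n)}
    {v : EuclideanSpace ℝ (Fin d)} (hx : x ∈ X) (hv : v ∈ Y) : bestResponse f Y L x v ∈ Y :=
  (h.bestResponse_spec hx hv).1

theorem inner_bestResponse_nonpos (h : MinimaxProblem f X Y L) {x : EuclideanSpace ℝ (Fin n)}
    {v q : EuclideanSpace ℝ (Fin d)} (hx : x ∈ X) (hv : v ∈ Y) (hq : q ∈ Y) :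
    ⟪gradY f x (bestResponse f Y L x v) - (2 * L) • (bestResponse f Y L x v - v),
      q - bestResponse f Y L x v⟫ ≤ 0 := by
  obtain ⟨h1, h2⟩ := h.bestResponse_spec hx hv
  refine inner_gradient_nonpos_of_isMaxOn
    (g := fun q => f x q - 2 * L / 2 * ‖q - v‖ ^ 2) ?_ h.convexY h1 hq h2
  have h3 := (h.hasGradientAt_snd x (bestResponse f Y L x v)).hasFDerivAt.sub
    (hasGradientAt_half_mul_norm_sub_sq (2 * L) v (bestResponse f Y L x v)).hasFDerivAt
  rw [hasGradientAt_iff_hasFDerivAt, map_sub]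
  exact h3

/-- Adding the two variational inequalities gives 2L‖b − b'‖² from the penalty. The Lipschitz
gradient takes back L‖b − b'‖², and the perturbations contribute L‖x − x'‖ and 2L‖v − v'‖; dividing
by L yields the constants 1 and 2. -/
theorem bestResponse_lipschitz (h : MinimaxProblem f X Y L) {x x' : EuclideanSpace ℝ (Fin n)}
    {v v' : EuclideanSpace ℝ (Fin d)} (hx : x ∈ X) (hx' : x' ∈ X) (hv : v ∈ Y) (hv' : v' ∈ Y) :
    ‖bestResponse f Y L x v - bestResponse f Y L x' v'‖ ≤ ‖x - x'‖ + 2 * ‖v - v'‖ := by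
  have hL := h.pos
  have hb := h.bestResponse_mem hx hv
  have hb' := h.bestResponse_mem hx' hv'
  have h1 := h.inner_bestResponse_nonpos hx hv hb'
  have h2 := h.inner_bestResponse_nonpos hx' hv' hb
  have h3 := h.gradY_lipschitz hx hx' hb hb'
  generalize bestResponse f Y L x v = b at *
  generalize bestResponse f Y L x' v' = b' at *
  have h4 : ⟪gradY f x b - gradY f x' b', b - b'⟫ ≤
      ‖gradY f x b - gradY f x' b'‖ * ‖b - b'‖ := real_inner_le_norm _ _
  have h5 : ⟪v - v', b - b'⟫ ≤ ‖v - v'‖ * ‖b - b'‖ := real_inner_le_norm _ _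
  have h6 : 2 * L * ‖b - b'‖ ^ 2 ≤
      ⟪gradY f x b - gradY f x' b', b - b'⟫ + 2 * L * ⟪v - v', b - b'⟫ := by
    have e1 : ‖b - b'‖ ^ 2 = ⟪b - b', b - b'⟫ := (real_inner_self_eq_norm_sq _).symm
    rw [e1]
    simp only [inner_sub_left, inner_sub_right, inner_smul_left, RCLike.conj_to_real] at h1 h2 ⊢
    linarith
  by_cases h0 : ‖b - b'‖ = 0
  · rw [h0]; positivity
  · have h7 : 0 < ‖b - b'‖ := lt_of_le_of_ne (norm_nonneg _) (Ne.symm h0)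
    have h8 := mul_le_mul_of_nonneg_right h3 h7.le
    have h9 : (L * ‖b - b'‖) * ‖b - b'‖ ≤ (L * ‖b - b'‖) * (‖x - x'‖ + 2 * ‖v - v'‖) := by
      nlinarith
    exact le_of_mul_le_mul_left h9 (by positivity)

/-- Curvature 2L of the penalty against at most L from f leaves strong concavity with modulus L. -/
theorem smoothedMax_growth (h : MinimaxProblem f X Y L) {x : EuclideanSpace ℝ (Fin n)}
    {v q : EuclideanSpace ℝ (Fin d)} (hx : x ∈ X) (hv : v ∈ Y) (hq : q ∈ Y) :
    f x q - L * ‖q - v‖ ^ 2 + L / 2 * ‖q - bestResponse f Y L x v‖ ^ 2 ≤ smoothedMax f Y L x v := by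
  have hb := h.bestResponse_mem hx hv
  have h1 := h.inner_bestResponse_nonpos hx hv hq
  have h2 := h.le_quadratic_snd hx hb hq
  have h3 : smoothedMax f Y L x v = f x (bestResponse f Y L x v) -
    2 * L / 2 * ‖bestResponse f Y L x v - v‖ ^ 2 := rfl
  rw [h3]
  generalize bestResponse f Y L x v = b at *
  have h4 : ‖q - v‖ ^ 2 = ‖q - b‖ ^ 2 + 2 * ⟪b - v, q - b⟫ + ‖b - v‖ ^ 2 := by
    have : q - v = (q - b) + (b - v) := by abel
    rw [this, norm_add_sq_real, real_inner_comm]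
  rw [inner_sub_left, inner_smul_left, RCLike.conj_to_real] at h1
  rw [h4]
  linarith

/-- Quadratic growth is tested at the proximal point, where f(x,·) dominates the primal value. It
turns the gap Φ − e into control of the only error in the v-step that movement does not control. -/
theorem sq_proxPoint_sub_bestResponse_le (h : MinimaxProblem f X Y L)
    {x : EuclideanSpace ℝ (Fin n)} {v : EuclideanSpace ℝ (Fin d)} (hx : x ∈ X) (hv : v ∈ Y) :
    L / 2 * ‖proxPoint f X Y L v - bestResponse f Y L x v‖ ^ 2 ≤
      smoothedMax f Y L x v - envelope f X Y L v := by
  have h1 := h.smoothedMax_growth hx hv (h.proxPoint_spec hv).1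
  have h2 := h.primalMin_le hx (proxPoint f X Y L v)
  have h3 : envelope f X Y L v = primalMin f X (proxPoint f X Y L v) -
    2 * L / 2 * ‖proxPoint f X Y L v - v‖ ^ 2 := rfl
  linarith

/-- Testing e at the best response cancels the proximal terms and leaves a pure primal gap, to which
the error bound applies. -/
theorem smoothedMax_sub_envelope_le (h : MinimaxProblem f X Y L)
    {x : EuclideanSpace ℝ (Fin n)} {v : EuclideanSpace ℝ (Fin d)} (hx : x ∈ X) (hv : v ∈ Y) :
    smoothedMax f Y L x v - envelope f X Y L v ≤
      f x (bestResponse f Y L x v) - primalMin f X (bestResponse f Y L x v) := by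
  have h1 := (h.proxPoint_spec hv).2 _ (h.bestResponse_mem hx hv)
  have h3 : smoothedMax f Y L x v = f x (bestResponse f Y L x v) -
    2 * L / 2 * ‖bestResponse f Y L x v - v‖ ^ 2 := rfl
  linarith

/-- Descent lemma with the Danskin gradient: L/2 comes from f, and another L from the 1-Lipschitz
shift of the best response inside the gradient. -/
theorem smoothedMax_le_of_fst (h : MinimaxProblem f X Y L) {x x' : EuclideanSpace ℝ (Fin n)}
    {v : EuclideanSpace ℝ (Fin d)} (hx : x ∈ X) (hx' : x' ∈ X) (hv : v ∈ Y) :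
    smoothedMax f Y L x' v ≤ smoothedMax f Y L x v +
      ⟪gradX f x (bestResponse f Y L x v), x' - x⟫ + 3 / 2 * L * ‖x' - x‖ ^ 2 := by
  have hL := h.pos
  have hb := h.bestResponse_mem hx hv
  have hb' := h.bestResponse_mem hx' hv
  have h1 := h.le_quadratic_fst hx hx' hb'
  have h2 := (h.bestResponse_spec hx hv).2 _ hb'
  have h3 := h.gradX_lipschitz hx hx hb' hb
  have h4 := h.bestResponse_lipschitz hx' hx hv hv
  have h5 : smoothedMax f Y L x' v = f x' (bestResponse f Y L x' v) -
    2 * L / 2 * ‖bestResponse f Y L x' v - v‖ ^ 2 := rfl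
  generalize bestResponse f Y L x v = b at *
  generalize bestResponse f Y L x' v = b' at *
  simp only [sub_self, norm_zero, mul_zero, add_zero, zero_add] at h3 h4
  have h6 := real_inner_le_norm (gradX f x b' - gradX f x b) (x' - x)
  rw [inner_sub_left] at h6
  have h7 : ‖gradX f x b' - gradX f x b‖ * ‖x' - x‖ ≤ L * ‖x' - x‖ ^ 2 := by
    have := mul_le_mul_of_nonneg_right (h3.trans (mul_le_mul_of_nonneg_left h4 hL.le))
      (norm_nonneg (x' - x))
    linarith
  linarith

theorem smoothedMax_le_of_snd (h : MinimaxProblem f X Y L) {x : EuclideanSpace ℝ (Fin n)}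
    {v v' : EuclideanSpace ℝ (Fin d)} (hx : x ∈ X) (hv : v ∈ Y) (hv' : v' ∈ Y) :
    smoothedMax f Y L x v' ≤ smoothedMax f Y L x v +
      L * (2 * ⟪v' - v, bestResponse f Y L x v' - v⟫ - ‖v' - v‖ ^ 2) := by
  have h1 := regMax_sub_le (r := 2 * L) (h.bestResponse_spec hx hv').1
    (h.bestResponse_spec hx hv).2
  change smoothedMax f Y L x v' ≤ smoothedMax f Y L x v - 2 * L / 2 *
    (‖bestResponse f Y L x v' - v'‖ ^ 2 - ‖bestResponse f Y L x v' - v‖ ^ 2) at h1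
  generalize bestResponse f Y L x v' = b at *
  have h2 : ‖b - v'‖ ^ 2 = ‖b - v‖ ^ 2 - 2 * ⟪v' - v, b - v⟫ + ‖v' - v‖ ^ 2 := by
    have : b - v' = (b - v) - (v' - v) := by abel
    rw [this, norm_sub_sq_real, real_inner_comm]
  rw [h2] at h1
  linarith

/-- A lower bound on e, evaluated at the old proximal point; its counterpart for Φ is an upper bound
at the new best response. These are the directions needed for Φ − 2e. -/
theorem le_envelope (h : MinimaxProblem f X Y L) {v v' : EuclideanSpace ℝ (Fin d)}
    (hv : v ∈ Y) (hv' : v' ∈ Y) :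
    envelope f X Y L v + L * (2 * ⟪v' - v, proxPoint f X Y L v - v⟫ - ‖v' - v‖ ^ 2) ≤
      envelope f X Y L v' := by
  have h1 := regMax_sub_le (r := 2 * L) (h.proxPoint_spec hv).1 (h.proxPoint_spec hv').2
  change envelope f X Y L v ≤ envelope f X Y L v' - 2 * L / 2 *
    (‖proxPoint f X Y L v - v‖ ^ 2 - ‖proxPoint f X Y L v - v'‖ ^ 2) at h1
  generalize proxPoint f X Y L v = b at *
  have h2 : ‖b - v'‖ ^ 2 = ‖b - v‖ ^ 2 - 2 * ⟪v' - v, b - v⟫ + ‖v' - v‖ ^ 2 := by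
    have : b - v' = (b - v) - (v' - v) := by abel
    rw [this, norm_sub_sq_real, real_inner_comm]
  rw [h2] at h1
  linarith

theorem envelope_le_smoothedMax (h : MinimaxProblem f X Y L)
    {x : EuclideanSpace ℝ (Fin n)} {v : EuclideanSpace ℝ (Fin d)} (hx : x ∈ X) (hv : v ∈ Y) :
    envelope f X Y L v ≤ smoothedMax f Y L x v := by
  have h1 := h.sq_proxPoint_sub_bestResponse_le hx hv
  have h2 : 0 ≤ L / 2 * ‖proxPoint f X Y L v - bestResponse f Y L x v‖ ^ 2 := by
    have := h.pos
    positivity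
  linarith

theorem exists_envelope_le (h : MinimaxProblem f X Y L) : ∃ M, ∀ v ∈ Y, envelope f X Y L v ≤ M := by
  obtain ⟨M, hM⟩ := h.bddAbove
  refine ⟨M, fun v hv => ?_⟩
  have h1 := hM ⟨_, (h.proxPoint_spec hv).1, rfl⟩
  have h3 : envelope f X Y L v = primalMin f X (proxPoint f X Y L v) -
    2 * L / 2 * ‖proxPoint f X Y L v - v‖ ^ 2 := rfl
  have h2 : 0 ≤ 2 * L / 2 * ‖proxPoint f X Y L v - v‖ ^ 2 := by
    have := h.pos
    positivity
  linarith

end MinimaxProblem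

/-! ### Parameters, potential and the scalar inequality -/

/-- The parameters used for DS-OGDA; all but the last depend only on `L`. -/
def stepParams (L β : ℝ) : Params where
  rx := L
  ry := 2 * L
  -- The inverse step 10⁹L outweighs 40000·6000·L, the cost in ‖Δx‖² of the drift of the best
  -- response under the weight 40000.
  ηx := 1 / (10 ^ 9 * L)
  ηy := 1 / (10 ^ 3 * L)
  βx := 1 / 2
  βy := β

/-- `w` and `u` are feasible, and the proximal centers of `u` come from those of `w`. -/
structure ConsecutivePair {n d : ℕ} (X : Set (EuclideanSpace ℝ (Fin n)))
    (Y : Set (EuclideanSpace ℝ (Fin d))) (β : ℝ) (w u : Iterate n d) : Prop where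
  prev_x : w.x ∈ X
  prev_y : w.y ∈ Y
  cur_x : u.x ∈ X
  cur_y : u.y ∈ Y
  cur_z : u.z ∈ X
  cur_v : u.v ∈ Y
  z_eq : u.z = w.z + (1 / 2 : ℝ) • (w.x - w.z)
  v_eq : u.v = w.v + β • (w.y - w.v)

/-- The Lyapunov function of DS-OGDA. -/
def lyapunov {n d : ℕ} (f : EuclideanSpace ℝ (Fin n) → EuclideanSpace ℝ (Fin d) → ℝ)
    (X : Set (EuclideanSpace ℝ (Fin n))) (Y : Set (EuclideanSpace ℝ (Fin d))) (L : ℝ)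
    (w u : Iterate n d) : ℝ :=
  smoothedMax f Y L u.x u.v - 2 * envelope f X Y L u.v +
    -- The weight 40000 makes the contraction of y − b dominate. The optimistic correction then
    -- costs 240 and 3840 on the previous displacements, which 300 and 5000 cover.
    L * (300 * ‖u.x - w.x‖ ^ 2 + 5000 * ‖u.y - w.y‖ ^ 2 +
      40000 * ‖u.y - bestResponse f Y L u.x u.v‖ ^ 2 + 40 * ‖u.x - u.z‖ ^ 2)

/-- The squared amount of movement around the iterate `u`, with predecessor `w` and successor
`u'`. -/
def movement {n d : ℕ} (f : EuclideanSpace ℝ (Fin n) → EuclideanSpace ℝ (Fin d) → ℝ)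
    (Y : Set (EuclideanSpace ℝ (Fin d))) (L : ℝ) (w u u' : Iterate n d) : ℝ :=
  ‖u'.x - u.x‖ ^ 2 + ‖u'.y - u.y‖ ^ 2 + ‖u.y - bestResponse f Y L u.x u.v‖ ^ 2 +
    ‖u.x - u.z‖ ^ 2 + ‖u.x - w.x‖ ^ 2 + ‖u.y - w.y‖ ^ 2

theorem movement_nonneg {n d : ℕ} (f : EuclideanSpace ℝ (Fin n) → EuclideanSpace ℝ (Fin d) → ℝ)
    (Y : Set (EuclideanSpace ℝ (Fin d))) (L : ℝ) (w u u' : Iterate n d) :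
    0 ≤ movement f Y L w u u' := by
  unfold movement; positivity

/-- The elementary inequality behind the decrease of the Lyapunov function. -/
theorem lyapunov_decrease_aux {p q p' q' d w s k β : ℝ} (hβ : 0 < β) (hβ' : β ≤ 1 / 10 ^ 10) :
    -(10 ^ 9 - 3 / 2) * p ^ 2 + (d + 2 * w + 3 * p' + q') * p
      + 2 * β * (s ^ 2 + s * (p + 2 * β * s + d)) - β ^ 2 * s ^ 2
      - 2 * (2 * β * (s ^ 2 - s * (k + p + d)) - β ^ 2 * s ^ 2)
      + 300 * p ^ 2 + 5000 * q ^ 2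
      + 40000 * ((1 - 1 / 4000) * d ^ 2 - 1 / 4 * q ^ 2
        + 6 / 1000 * (16 * q' ^ 2 + p' ^ 2 + 16 * β ^ 2 * s ^ 2)
        + 3000 * (2 * p ^ 2 + 8 * β ^ 2 * s ^ 2))
      + 40 * (1 / 2 * w ^ 2 + 2 * p ^ 2)
    ≤ 300 * p' ^ 2 + 5000 * q' ^ 2 + 40000 * d ^ 2 + 40 * w ^ 2
      - (p ^ 2 + q ^ 2 + d ^ 2 + w ^ 2 + p' ^ 2 + q' ^ 2) - 1 / 4 * β * s ^ 2 + 8 * β * k ^ 2 := by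
  have y1 : (d + 2 * w + 3 * p' + q') * p ≤
      p ^ 2 + (d ^ 2 + 4 * w ^ 2 + 9 * p' ^ 2 + q' ^ 2) := by
    nlinarith [sq_nonneg (d - p / 2), sq_nonneg (2 * w - p / 2), sq_nonneg (3 * p' - p / 2),
      sq_nonneg (q' - p / 2)]
  -- The s² terms of Φ and −2e combine to −2βs². These cross terms use up one βs², and 8βk² is left
  -- for the gap.
  have y2 : 6 * s * (p + d) + 4 * s * k ≤ s ^ 2 + 36 * (p ^ 2 + d ^ 2) + 8 * k ^ 2 := by
    nlinarith [sq_nonneg (s - 12 * p), sq_nonneg (s - 12 * d), sq_nonneg (s - 4 * k)]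
  have y3 := mul_le_mul_of_nonneg_left y2 hβ.le
  have y4 : β * (p ^ 2 + d ^ 2) ≤ 1 / 10 ^ 10 * (p ^ 2 + d ^ 2) :=
    mul_le_mul_of_nonneg_right hβ' (by positivity)
  -- The coefficient of β²s² is just under 10⁹, so β ≤ 10⁻¹⁰ keeps it below about a tenth of βs².
  have y5 : β ^ 2 * s ^ 2 ≤ 1 / 10 ^ 10 * (β * s ^ 2) := by
    have : β * (β * s ^ 2) ≤ 1 / 10 ^ 10 * (β * s ^ 2) :=
      mul_le_mul_of_nonneg_right hβ' (by positivity)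
    linarith
  have y6 : 0 ≤ β * s ^ 2 := by positivity
  have := sq_nonneg p
  have := sq_nonneg q
  have := sq_nonneg d
  have := sq_nonneg w
  have := sq_nonneg p'
  have := sq_nonneg q'
  linarith

theorem norm_four_le {E : Type*} [SeminormedAddCommGroup E] (a b c d : E) :
    ‖a + b + c + d‖ ≤ ‖a‖ + ‖b‖ + ‖c‖ + ‖d‖ :=
  (norm_add_le _ _).trans (by linarith [norm_add₃_le (a := a) (b := b) (c := c)])

/-! ### Descent of the potential along one step -/

namespace MinimaxProblem

variable {n d : ℕ} {f : EuclideanSpace ℝ (Fin n) → EuclideanSpace ℝ (Fin d) → ℝ}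
  {X : Set (EuclideanSpace ℝ (Fin n))} {Y : Set (EuclideanSpace ℝ (Fin d))} {L β : ℝ}
  {w u : Iterate n d}

/-- Since β_x = 1/2, w.x − w.z = 2(w.x − u.z); the old center disappears and the coefficient 3 is 1
from the gradient plus 2 from this identity. -/
theorem norm_Gx_sub_le (h : MinimaxProblem f X Y L) (hp : ConsecutivePair X Y β w u) :
    ‖Gx f (stepParams L β) w - Gx f (stepParams L β) u‖ ≤
      L * (3 * ‖u.x - w.x‖ + ‖u.y - w.y‖ + ‖u.x - u.z‖) := by
  have hL := h.pos
  have h1 := h.gradX_lipschitz hp.prev_x hp.cur_x hp.prev_y hp.cur_y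
  have h2 : Gx f (stepParams L β) w - Gx f (stepParams L β) u =
      (gradX f w.x w.y - gradX f u.x u.y) +
        L • ((u.x - u.z) + ((w.x - u.x) + (w.x - u.x))) := by
    rw [h.Gx_eq, h.Gx_eq, hp.z_eq]
    simp only [stepParams]
    module
  rw [h2]
  refine (norm_add_le _ _).trans ?_
  rw [norm_smul, Real.norm_of_nonneg hL.le]
  have h3 : ‖(u.x - u.z) + ((w.x - u.x) + (w.x - u.x))‖ ≤
      ‖u.x - u.z‖ + (‖w.x - u.x‖ + ‖w.x - u.x‖) :=
    (norm_add_le _ _).trans (by gcongr; exact norm_add_le _ _)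
  rw [norm_sub_rev u.x w.x, norm_sub_rev u.y w.y]
  nlinarith

/-- The old center is eliminated through (1 − β)(w.y − w.v) = (u.y − u.v) − (u.y − w.y). The
coefficient 4 is 1 from the gradient, 2 from the penalty and 4β ≤ 1 from the drift of v. -/
theorem norm_Gy_sub_le (h : MinimaxProblem f X Y L) (hp : ConsecutivePair X Y β w u)
    (hβ : 0 < β) (hβ' : β ≤ 1 / 4) :
    ‖Gy f (stepParams L β) w - Gy f (stepParams L β) u‖ ≤
      L * (‖u.x - w.x‖ + 4 * ‖u.y - w.y‖ + 4 * β * ‖u.y - u.v‖) := by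
  have hL := h.pos
  have h1 := h.gradY_lipschitz hp.cur_x hp.prev_x hp.cur_y hp.prev_y
  have h2 : Gy f (stepParams L β) w - Gy f (stepParams L β) u =
      (gradY f u.x u.y - gradY f w.x w.y) - (2 * L) • (u.y - w.y) +
        (2 * L * β) • (w.y - w.v) := by
    rw [h.Gy_eq, h.Gy_eq, hp.v_eq]
    simp only [stepParams]
    module
  have h3 : (1 - β) * ‖w.y - w.v‖ ≤ ‖u.y - u.v‖ + ‖u.y - w.y‖ := by
    have : (1 - β) • (w.y - w.v) = (u.y - u.v) - (u.y - w.y) := by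
      rw [hp.v_eq]; module
    rw [← Real.norm_of_nonneg (show 0 ≤ 1 - β by linarith), ← norm_smul, this]
    exact norm_sub_le _ _
  have h4 : β * ‖w.y - w.v‖ ≤ 2 * β * (‖u.y - u.v‖ + ‖u.y - w.y‖) := by
    have : β * ‖w.y - w.v‖ * (1 / 2) ≤ β * (‖u.y - u.v‖ + ‖u.y - w.y‖) := by
      rw [mul_assoc]
      refine mul_le_mul_of_nonneg_left (le_trans ?_ h3) hβ.le
      nlinarith [norm_nonneg (w.y - w.v)]
    linarith
  have h5 : β * ‖u.y - w.y‖ ≤ 1 / 4 * ‖u.y - w.y‖ :=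
    mul_le_mul_of_nonneg_right hβ' (norm_nonneg _)
  have h6 := mul_le_mul_of_nonneg_left h4 hL.le
  have h7 := mul_le_mul_of_nonneg_left h5 hL.le
  rw [h2]
  refine (norm_add_le _ _).trans ((add_le_add_left (norm_sub_le _ _) _).trans ?_)
  rw [norm_smul, norm_smul, Real.norm_of_nonneg (by positivity : 0 ≤ 2 * L),
    Real.norm_of_nonneg (by positivity : 0 ≤ 2 * L * β)]
  linarith

theorem step_mem_x (h : MinimaxProblem f X Y L) (P : Params) (w u : Iterate n d) :
    (dsogdaStep f X Y P w u).x ∈ X :=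
  (projOnto_spec h.nonemptyX h.compactX.isClosed h.convexX _).1

theorem step_mem_y (h : MinimaxProblem f X Y L) (P : Params) (w : Iterate n d) (hu : u.y ∈ Y) :
    (dsogdaStep f X Y P w u).y ∈ Y :=
  (projOnto_spec ⟨_, hu⟩ h.closedY h.convexY _).1

theorem step_mem_v (h : MinimaxProblem f X Y L) (hp : ConsecutivePair X Y β w u)
    (hβ : 0 < β) (hβ' : β ≤ 1) : (dsogdaStep f X Y (stepParams L β) w u).v ∈ Y :=
  h.convexY.add_smul_sub_mem hp.cur_v hp.cur_y ⟨hβ.le, hβ'⟩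

theorem consecutivePair_step (h : MinimaxProblem f X Y L) (hp : ConsecutivePair X Y β w u)
    (hβ : 0 < β) (hβ' : β ≤ 1) :
    ConsecutivePair X Y β u (dsogdaStep f X Y (stepParams L β) w u) where
  prev_x := hp.cur_x
  prev_y := hp.cur_y
  cur_x := h.step_mem_x _ _ _
  cur_y := h.step_mem_y _ _ hp.cur_y
  cur_z := h.convexX.add_smul_sub_mem hp.cur_z hp.cur_x
    (t := (1 / 2 : ℝ)) ⟨by norm_num, by norm_num⟩
  cur_v := h.step_mem_v hp hβ hβ'
  z_eq := rfl
  v_eq := rfl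

/-- The normal vector produced by the projection step in `x`. -/
theorem normal_x (h : MinimaxProblem f X Y L) (w u : Iterate n d) :
    (Gx f (stepParams L β) w - Gx f (stepParams L β) u) - Gx f (stepParams L β) u -
      (10 ^ 9 * L) • ((dsogdaStep f X Y (stepParams L β) w u).x - u.x) ∈
      indicatorSubdifferential X (dsogdaStep f X Y (stepParams L β) w u).x := by
  intro q hq
  have hL := h.pos
  have h1 := (projOnto_spec h.nonemptyX h.compactX.isClosed h.convexX
    (u.x - (stepParams L β).ηx • Gx f (stepParams L β) u +
      (stepParams L β).ηx • (Gx f (stepParams L β) w - Gx f (stepParams L β) u))).2 q hq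
  change ⟪_ - (dsogdaStep f X Y (stepParams L β) w u).x,
    q - (dsogdaStep f X Y (stepParams L β) w u).x⟫ ≤ 0 at h1
  generalize dsogdaStep f X Y (stepParams L β) w u = u' at *
  have h2 := mul_nonpos_of_nonneg_of_nonpos (show 0 ≤ 10 ^ 9 * L by positivity) h1
  rw [← real_inner_smul_left] at h2
  refine le_of_eq_of_le (congrArg (⟪·, _⟫) ?_) h2
  have h3 : (10 ^ 9 * L) * (stepParams L β).ηx = 1 := by
    simp only [stepParams]; field_simp
  simp only [smul_sub, smul_add, smul_smul, h3, one_smul]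
  abel

/-- The normal vector produced by the projection step in `y`. -/
theorem normal_y (h : MinimaxProblem f X Y L) (w : Iterate n d) (hu : u.y ∈ Y) :
    (Gy f (stepParams L β) w - Gy f (stepParams L β) u) - Gy f (stepParams L β) u -
      (10 ^ 3 * L) • ((dsogdaStep f X Y (stepParams L β) w u).y - u.y) ∈
      indicatorSubdifferential Y (dsogdaStep f X Y (stepParams L β) w u).y := by
  intro q hq
  have hL := h.pos
  have h1 := (projOnto_spec ⟨_, hu⟩ h.closedY h.convexY
    (u.y - (stepParams L β).ηy • Gy f (stepParams L β) u +
      (stepParams L β).ηy • (Gy f (stepParams L β) w - Gy f (stepParams L β) u))).2 q hq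
  change ⟪_ - (dsogdaStep f X Y (stepParams L β) w u).y,
    q - (dsogdaStep f X Y (stepParams L β) w u).y⟫ ≤ 0 at h1
  generalize dsogdaStep f X Y (stepParams L β) w u = u' at *
  have h2 := mul_nonpos_of_nonneg_of_nonpos (show 0 ≤ 10 ^ 3 * L by positivity) h1
  rw [← real_inner_smul_left] at h2
  refine le_of_eq_of_le (congrArg (⟪·, _⟫) ?_) h2
  have h3 : (10 ^ 3 * L) * (stepParams L β).ηy = 1 := by
    simp only [stepParams]; field_simp
  simp only [smul_sub, smul_add, smul_smul, h3, one_smul]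
  abel

/-- Decrease of the smoothed maximum along the step in `x`. -/
theorem smoothedMax_step_fst (h : MinimaxProblem f X Y L) (hp : ConsecutivePair X Y β w u)
    {u' : Iterate n d} (hu' : u' = dsogdaStep f X Y (stepParams L β) w u) :
    smoothedMax f Y L u'.x u.v ≤ smoothedMax f Y L u.x u.v +
      L * (-(10 ^ 9 - 3 / 2) * ‖u'.x - u.x‖ ^ 2 +
        (‖u.y - bestResponse f Y L u.x u.v‖ + 2 * ‖u.x - u.z‖ + 3 * ‖u.x - w.x‖ +
          ‖u.y - w.y‖) * ‖u'.x - u.x‖) := by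
  have hL := h.pos
  have hx' : u'.x ∈ X := hu' ▸ h.step_mem_x _ _ _
  have h1 := h.smoothedMax_le_of_fst hp.cur_x hx' hp.cur_v
  have h2 := h.normal_x (β := β) w u u.x hp.cur_x
  rw [← hu'] at h2
  have h3 := h.norm_Gx_sub_le hp
  have h4 := h.gradX_lipschitz hp.cur_x hp.cur_x (h.bestResponse_mem hp.cur_x hp.cur_v) hp.cur_y
  rw [h.Gx_eq _ u] at h2 h3
  generalize Gx f (stepParams L β) w - _ = e at *
  simp only [stepParams, sub_self, norm_zero, zero_add] at h2 h4
  have h5 : gradX f u.x (bestResponse f Y L u.x u.v) =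
      (gradX f u.x (bestResponse f Y L u.x u.v) - gradX f u.x u.y) + (-(L • (u.x - u.z))) + e +
        (gradX f u.x u.y + L • (u.x - u.z) - e) := by abel
  have h6 : ‖(gradX f u.x (bestResponse f Y L u.x u.v) - gradX f u.x u.y) +
      (-(L • (u.x - u.z))) + e‖ ≤ L * (‖u.y - bestResponse f Y L u.x u.v‖ + 2 * ‖u.x - u.z‖ +
        3 * ‖u.x - w.x‖ + ‖u.y - w.y‖) := by
    refine norm_add₃_le.trans ?_
    rw [norm_neg, norm_smul, Real.norm_of_nonneg hL.le, norm_sub_rev u.y]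
    linarith
  have h7 := (real_inner_le_norm ((gradX f u.x (bestResponse f Y L u.x u.v) - gradX f u.x u.y) +
    (-(L • (u.x - u.z))) + e) (u'.x - u.x)).trans
    (mul_le_mul_of_nonneg_right h6 (norm_nonneg _))
  rw [h5, inner_add_left] at h1
  have h8 : ⟪gradX f u.x u.y + L • (u.x - u.z) - e, u'.x - u.x⟫ ≤
      -(10 ^ 9 * L) * ‖u'.x - u.x‖ ^ 2 := by
    have e1 : u.x - u'.x = -(u'.x - u.x) := by abel
    have e2 : e - (gradX f u.x u.y + L • (u.x - u.z)) =
      -(gradX f u.x u.y + L • (u.x - u.z) - e) := by abel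
    rw [e1, e2, inner_neg_right, inner_sub_left, inner_neg_left, real_inner_smul_left,
      real_inner_self_eq_norm_sq] at h2
    linarith
  linarith

/-- Contraction of the step in `y` towards the best response. -/
theorem bestResponse_contraction (h : MinimaxProblem f X Y L) (hp : ConsecutivePair X Y β w u)
    (hβ : 0 < β) (hβ' : β ≤ 1 / 4)
    {u' : Iterate n d} (hu' : u' = dsogdaStep f X Y (stepParams L β) w u) :
    (1 + 1 / 1000) * ‖u'.y - bestResponse f Y L u.x u.v‖ ^ 2 ≤
      ‖u.y - bestResponse f Y L u.x u.v‖ ^ 2 - 1 / 2 * ‖u'.y - u.y‖ ^ 2 +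
        2 / 1000 * (‖u.x - w.x‖ + 4 * ‖u.y - w.y‖ + 4 * β * ‖u.y - u.v‖) ^ 2 := by
  have hL := h.pos
  have hy' : u'.y ∈ Y := hu' ▸ h.step_mem_y _ _ hp.cur_y
  have hb := h.bestResponse_mem hp.cur_x hp.cur_v
  have h1 := h.normal_y (β := β) w hp.cur_y _ hb
  rw [← hu'] at h1
  have h2 := h.norm_Gy_sub_le hp hβ hβ'
  have h3 := h.inner_bestResponse_nonpos hp.cur_x hp.cur_v hy'
  have h4 := h.gradY_lipschitz hp.cur_x hp.cur_x hp.cur_y hb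
  generalize bestResponse f Y L u.x u.v = b at *
  have h4' := h.gradY_lipschitz hp.cur_x hp.cur_x hy' hb
  have h5 := h.gradY_lipschitz hp.cur_x hp.cur_x hp.cur_y hy'
  rw [h.Gy_eq _ u] at h1 h2
  generalize Gy f (stepParams L β) w - _ = e at *
  set ε := ‖u.x - w.x‖ + 4 * ‖u.y - w.y‖ + 4 * β * ‖u.y - u.v‖
  simp only [stepParams, sub_self, norm_zero, zero_add] at h1 h4 h4' h5
  set D := u'.y - b with hD
  set q := u'.y - u.y with hq
  have e1 : b - u'.y = -D := by rw [hD]; abel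
  -- Inserting the optimality condition at b, with D = y' − b: the penalty contributes −2L‖D‖² and
  -- the gradient at most L‖D‖², so strong monotonicity with modulus L remains.
  have e2 : e - (-gradY f u.x u.y + (2 * L) • (u.y - u.v)) - (10 ^ 3 * L) • q =
      e + (gradY f u.x u.y - gradY f u.x u'.y) + (gradY f u.x u'.y - gradY f u.x b) +
        (gradY f u.x b - (2 * L) • (b - u.v)) - (2 * L) • D + (2 * L) • q - (10 ^ 3 * L) • q := by
    rw [hD, hq]; module
  rw [e1, e2] at h1
  have n0 : ⟪gradY f u.x b - (2 * L) • (b - u.v), D⟫ ≤ 0 := h3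
  have n1 : ⟪e, D⟫ ≤ L * ε * ‖D‖ :=
    (real_inner_le_norm _ _).trans (mul_le_mul_of_nonneg_right h2 (norm_nonneg _))
  have n2 : ⟪gradY f u.x u.y - gradY f u.x u'.y, D⟫ ≤ L * ‖q‖ * ‖D‖ := by
    rw [hq, norm_sub_rev]
    exact (real_inner_le_norm _ _).trans (mul_le_mul_of_nonneg_right h5 (norm_nonneg _))
  have n3 : ⟪gradY f u.x u'.y - gradY f u.x b, D⟫ ≤ L * ‖D‖ * ‖D‖ :=
    (real_inner_le_norm _ _).trans (mul_le_mul_of_nonneg_right h4' (norm_nonneg _))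
  have n4 : ⟪q, D⟫ ≤ ‖q‖ * ‖D‖ := real_inner_le_norm _ _
  have n5 : ‖u.y - b‖ ^ 2 = ‖D‖ ^ 2 - 2 * ⟪q, D⟫ + ‖q‖ ^ 2 := by
    have : u.y - b = D - q := by rw [hD, hq]; abel
    rw [this, norm_sub_sq_real, real_inner_comm]
  simp only [inner_neg_right, inner_add_left, inner_sub_left, real_inner_smul_left] at h1 n0 n2 n3
  have hDD : ⟪D, D⟫ = ‖D‖ ^ 2 := real_inner_self_eq_norm_sq _
  rw [hDD] at h1
  have k1 : 10 ^ 3 * L * ⟪q, D⟫ ≤ L * (ε * ‖D‖ + 3 * (‖q‖ * ‖D‖) - ‖D‖ ^ 2) := by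
    nlinarith [mul_le_mul_of_nonneg_left n4 hL.le]
  have k2 : 10 ^ 3 * ⟪q, D⟫ ≤ ε * ‖D‖ + 3 * (‖q‖ * ‖D‖) - ‖D‖ ^ 2 := by
    refine le_of_mul_le_mul_left ?_ hL
    linarith
  rw [n5]
  have y1 : ε * ‖D‖ ≤ ε ^ 2 + ‖D‖ ^ 2 / 4 := by nlinarith [sq_nonneg (ε - ‖D‖ / 2)]
  have y2 : 3 * (‖q‖ * ‖D‖) ≤ ‖D‖ ^ 2 / 4 + 9 * ‖q‖ ^ 2 := by
    nlinarith [sq_nonneg (3 * ‖q‖ - ‖D‖ / 2)]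
  have := sq_nonneg ‖q‖
  linarith

/-- Recursion for the distance to the best response. -/
theorem bestResponse_recursion (h : MinimaxProblem f X Y L) (hp : ConsecutivePair X Y β w u)
    (hβ : 0 < β) (hβ' : β ≤ 1 / 4)
    {u' : Iterate n d} (hu' : u' = dsogdaStep f X Y (stepParams L β) w u) :
    ‖u'.y - bestResponse f Y L u'.x u'.v‖ ^ 2 ≤
      (1 - 1 / 4000) * ‖u.y - bestResponse f Y L u.x u.v‖ ^ 2 - 1 / 4 * ‖u'.y - u.y‖ ^ 2 +
        6 / 1000 * (16 * ‖u.y - w.y‖ ^ 2 + ‖u.x - w.x‖ ^ 2 + 16 * β ^ 2 * ‖u.y - u.v‖ ^ 2) +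
        3000 * (2 * ‖u'.x - u.x‖ ^ 2 + 8 * β ^ 2 * ‖u.y - u.v‖ ^ 2) := by
  have h1 := h.bestResponse_contraction hp hβ hβ' hu'
  have hx' : u'.x ∈ X := hu' ▸ h.step_mem_x _ _ _
  have hv' : u'.v ∈ Y := hu' ▸ h.step_mem_v hp hβ (by linarith)
  have h2 := h.bestResponse_lipschitz hx' hp.cur_x hv' hp.cur_v
  have h3 : u'.v - u.v = β • (u.y - u.v) := by
    rw [hu']; simp [dsogdaStep, stepParams]
  rw [h3, norm_smul, Real.norm_of_nonneg hβ.le] at h2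
  generalize bestResponse f Y L u.x u.v = b at *
  generalize bestResponse f Y L u'.x u'.v = b' at *
  have h4 : ‖u'.y - b'‖ ≤ ‖u'.y - b‖ + (‖u'.x - u.x‖ + 2 * (β * ‖u.y - u.v‖)) := by
    have : u'.y - b' = (u'.y - b) - (b' - b) := by abel
    rw [this]
    exact (norm_sub_le _ _).trans (by linarith)
  -- Young's inequality with weight 1/2000 spends about half of the contraction factor 1/(1 +
  -- 1/1000) on the motion of b.
  have h5 : ‖u'.y - b'‖ ^ 2 ≤ (1 + 1 / 2000) * ‖u'.y - b‖ ^ 2 +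
      2001 * (‖u'.x - u.x‖ + 2 * (β * ‖u.y - u.v‖)) ^ 2 := by
    refine (pow_le_pow_left₀ (norm_nonneg _) h4 2).trans ?_
    generalize ‖u'.x - u.x‖ + 2 * (β * ‖u.y - u.v‖) = c
    generalize ‖u'.y - b‖ = a
    nlinarith [sq_nonneg (a - 2000 * c)]
  have h6 : (‖u'.x - u.x‖ + 2 * (β * ‖u.y - u.v‖)) ^ 2 ≤
      2 * ‖u'.x - u.x‖ ^ 2 + 8 * (β * ‖u.y - u.v‖) ^ 2 := by
    nlinarith [sq_nonneg (‖u'.x - u.x‖ - 2 * (β * ‖u.y - u.v‖))]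
  have h7 : (‖u.x - w.x‖ + 4 * ‖u.y - w.y‖ + 4 * β * ‖u.y - u.v‖) ^ 2 ≤
      3 * (‖u.x - w.x‖ ^ 2 + 16 * ‖u.y - w.y‖ ^ 2 + 16 * (β * ‖u.y - u.v‖) ^ 2) := by
    have : ∀ a b c : ℝ, (a + b + c) ^ 2 ≤ 3 * (a ^ 2 + b ^ 2 + c ^ 2) := fun a b c => by
      nlinarith [sq_nonneg (a - b), sq_nonneg (b - c), sq_nonneg (a - c)]
    have := this ‖u.x - w.x‖ (4 * ‖u.y - w.y‖) (4 * β * ‖u.y - u.v‖)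
    linarith
  rw [mul_pow] at h6 h7
  have := sq_nonneg ‖u'.x - u.x‖
  have := sq_nonneg ‖u'.y - u.y‖
  have := sq_nonneg ‖u.y - b‖
  have := sq_nonneg ‖u.x - w.x‖
  have := sq_nonneg ‖u.y - w.y‖
  have : 0 ≤ β ^ 2 * ‖u.y - u.v‖ ^ 2 := by positivity
  linarith

/-- One step of DS-OGDA decreases the Lyapunov function up to the gap of the primal problem. -/
theorem lyapunov_step (h : MinimaxProblem f X Y L) (hp : ConsecutivePair X Y β w u)
    (hβ : 0 < β) (hβ' : β ≤ 1 / 10 ^ 10)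
    {u' : Iterate n d} (hu' : u' = dsogdaStep f X Y (stepParams L β) w u) :
    lyapunov f X Y L u u' ≤ lyapunov f X Y L w u - L * movement f Y L w u u' -
      L / 4 * β * ‖u.y - u.v‖ ^ 2 +
        16 * β * (smoothedMax f Y L u'.x u.v - envelope f X Y L u.v) := by
  have hL := h.pos
  have hβ4 : β ≤ 1 / 4 := hβ'.trans (by norm_num)
  have hx' : u'.x ∈ X := hu' ▸ h.step_mem_x _ _ _
  have hv' : u'.v ∈ Y := hu' ▸ h.step_mem_v hp hβ (by linarith)
  have h1 := h.smoothedMax_step_fst hp hu'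
  have h2 := h.smoothedMax_le_of_snd hx' hp.cur_v hv'
  have h3 := h.le_envelope hp.cur_v hv'
  have h4 := h.bestResponse_recursion hp hβ hβ4 hu'
  have h5 := h.sq_proxPoint_sub_bestResponse_le hx' hp.cur_v
  have hv : u'.v - u.v = β • (u.y - u.v) := by
    rw [hu']; simp [dsogdaStep, stepParams]
  have hz : u'.x - u'.z = (1 / 2 : ℝ) • (u.x - u.z) + (u'.x - u.x) := by
    rw [show u'.z = u.z + (1 / 2 : ℝ) • (u.x - u.z) by rw [hu']; rfl]; module
  have h6 : ‖u'.x - u'.z‖ ^ 2 ≤ 1 / 2 * ‖u.x - u.z‖ ^ 2 + 2 * ‖u'.x - u.x‖ ^ 2 := by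
    have := norm_add_le ((1 / 2 : ℝ) • (u.x - u.z)) (u'.x - u.x)
    rw [← hz, norm_smul, Real.norm_of_nonneg (by norm_num)] at this
    refine (pow_le_pow_left₀ (norm_nonneg _) this 2).trans ?_
    nlinarith [sq_nonneg (1 / 2 * ‖u.x - u.z‖ - ‖u'.x - u.x‖)]
  have l1 := h.bestResponse_lipschitz hx' hp.cur_x hv' hp.cur_v
  have l2 := h.bestResponse_lipschitz hx' hp.cur_x hp.cur_v hp.cur_v
  rw [hv, norm_smul, Real.norm_of_nonneg hβ.le] at l1
  rw [hv, real_inner_smul_left, norm_smul, Real.norm_of_nonneg hβ.le, mul_pow] at h2 h3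
  rw [sub_self, norm_zero, mul_zero, add_zero] at l2
  simp only [lyapunov, movement]
  set s := ‖u.y - u.v‖
  generalize bestResponse f Y L u.x u.v = b at *
  generalize bestResponse f Y L u'.x u'.v = b' at *
  generalize bestResponse f Y L u'.x u.v = b'' at *
  generalize proxPoint f X Y L u.v = g at *
  have m1 : ⟪u.y - u.v, b' - u.v⟫ ≤ s ^ 2 + s * (‖u'.x - u.x‖ + 2 * β * s + ‖u.y - b‖) := by
    have e : b' - u.v = (u.y - u.v) + ((b' - b) - (u.y - b)) := by abel
    rw [e, inner_add_right, real_inner_self_eq_norm_sq]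
    have := (real_inner_le_norm (u.y - u.v) ((b' - b) - (u.y - b))).trans
      (mul_le_mul_of_nonneg_left ((norm_sub_le _ _).trans (add_le_add_left l1 _)) (norm_nonneg _))
    linarith
  have m2 : s ^ 2 - s * (‖g - b''‖ + ‖u'.x - u.x‖ + ‖u.y - b‖) ≤ ⟪u.y - u.v, g - u.v⟫ := by
    have e : g - u.v = (u.y - u.v) - ((b'' - g) + -(b'' - b) + (u.y - b)) := by abel
    rw [e, inner_sub_right, real_inner_self_eq_norm_sq]
    have := (real_inner_le_norm (u.y - u.v) ((b'' - g) + -(b'' - b) + (u.y - b))).trans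
      (mul_le_mul_of_nonneg_left norm_add₃_le (norm_nonneg _))
    rw [norm_neg, norm_sub_rev b'' g] at this
    have := mul_le_mul_of_nonneg_left l2 (norm_nonneg (u.y - u.v))
    linarith
  have main := lyapunov_decrease_aux (p := ‖u'.x - u.x‖) (q := ‖u'.y - u.y‖) (p' := ‖u.x - w.x‖)
    (q' := ‖u.y - w.y‖) (d := ‖u.y - b‖) (w := ‖u.x - u.z‖) (s := s) (k := ‖g - b''‖) hβ hβ'
  have r1 := mul_le_mul_of_nonneg_left m1 (show 0 ≤ 2 * L * β by positivity)
  have r2 := mul_le_mul_of_nonneg_left m2 (show 0 ≤ 4 * L * β by positivity)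
  -- The factor 16β on (L/2)‖g − b''‖² matches the 8Lβk² left over by the scalar inequality.
  have r3 := mul_le_mul_of_nonneg_left h5 (show 0 ≤ 16 * β by positivity)
  have r4 := mul_le_mul_of_nonneg_left h4 (show 0 ≤ 40000 * L by positivity)
  have r5 := mul_le_mul_of_nonneg_left h6 (show 0 ≤ 40 * L by positivity)
  have r6 := mul_le_mul_of_nonneg_left main hL.le
  linarith

end MinimaxProblem

/-! ### Residuals, error bounds and averaging -/

namespace MinimaxProblem

variable {n d : ℕ} {f : EuclideanSpace ℝ (Fin n) → EuclideanSpace ℝ (Fin d) → ℝ}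
  {X : Set (EuclideanSpace ℝ (Fin n))} {Y : Set (EuclideanSpace ℝ (Fin d))} {L β : ℝ}
  {w u : Iterate n d}

/-- The projection supplies an explicit normal vector, whose sum with the gradient is a sum of
displacements. The point y is free so that both the new dual iterate and the best response can be
inserted. -/
theorem primalResidual_step_le (h : MinimaxProblem f X Y L) (hp : ConsecutivePair X Y β w u)
    {u' : Iterate n d} (hu' : u' = dsogdaStep f X Y (stepParams L β) w u)
    {y : EuclideanSpace ℝ (Fin d)} (hy : y ∈ Y) :
    primalResidual f X u'.x y ≤ L * (‖y - u.y‖ + (10 ^ 9 + 1) * ‖u'.x - u.x‖ +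
      2 * ‖u.x - u.z‖ + 3 * ‖u.x - w.x‖ + ‖u.y - w.y‖) := by
  have hL := h.pos
  have hx' : u'.x ∈ X := hu' ▸ h.step_mem_x _ _ _
  have h1 := h.normal_x (β := β) w u
  rw [← hu'] at h1
  have h2 := h.norm_Gx_sub_le hp
  have h3 := h.gradX_lipschitz hx' hp.cur_x hy hp.cur_y
  rw [h.Gx_eq _ u] at h1 h2
  generalize Gx f (stepParams L β) w - _ = e at *
  refine (Metric.infDist_le_dist_of_mem (Set.mem_image_of_mem _ h1)).trans ?_
  simp only [stepParams, dist_zero_left]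
  have e1 : gradX f u'.x y + (e - (gradX f u.x u.y + L • (u.x - u.z)) -
      (10 ^ 9 * L) • (u'.x - u.x)) = (gradX f u'.x y - gradX f u.x u.y) + e +
      (-(L • (u.x - u.z))) + (-((10 ^ 9 * L) • (u'.x - u.x))) := by abel
  rw [e1]
  refine (norm_four_le _ _ _ _).trans ?_
  rw [norm_neg, norm_neg, norm_smul, norm_smul, Real.norm_of_nonneg hL.le,
    Real.norm_of_nonneg (by positivity : 0 ≤ 10 ^ 9 * L)]
  linarith

theorem dualResidual_step_le (h : MinimaxProblem f X Y L) (hp : ConsecutivePair X Y β w u)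
    (hβ : 0 < β) (hβ' : β ≤ 1 / 4)
    {u' : Iterate n d} (hu' : u' = dsogdaStep f X Y (stepParams L β) w u) :
    dualResidual f Y u'.x u'.y ≤ L * (‖u'.x - u.x‖ + 1001 * ‖u'.y - u.y‖ + ‖u.x - w.x‖ +
      4 * ‖u.y - w.y‖ + 3 * ‖u.y - u.v‖) := by
  have hL := h.pos
  have hx' : u'.x ∈ X := hu' ▸ h.step_mem_x _ _ _
  have hy' : u'.y ∈ Y := hu' ▸ h.step_mem_y _ _ hp.cur_y
  have h1 := h.normal_y (β := β) w hp.cur_y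
  rw [← hu'] at h1
  have h2 := h.norm_Gy_sub_le hp hβ hβ'
  have h3 := h.gradY_lipschitz hp.cur_x hx' hp.cur_y hy'
  rw [norm_sub_rev u.x, norm_sub_rev u.y] at h3
  rw [h.Gy_eq _ u] at h1 h2
  generalize Gy f (stepParams L β) w - _ = e at *
  refine (Metric.infDist_le_dist_of_mem (Set.mem_image_of_mem _ h1)).trans ?_
  simp only [stepParams, dist_zero_left]
  have e1 : -gradY f u'.x u'.y + (e - (-gradY f u.x u.y + (2 * L) • (u.y - u.v)) -
      (10 ^ 3 * L) • (u'.y - u.y)) = (gradY f u.x u.y - gradY f u'.x u'.y) + e +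
      (-((2 * L) • (u.y - u.v))) + (-((10 ^ 3 * L) • (u'.y - u.y))) := by abel
  rw [e1]
  refine (norm_four_le _ _ _ _).trans ?_
  rw [norm_neg, norm_neg, norm_smul, norm_smul, Real.norm_of_nonneg (by positivity : 0 ≤ 2 * L),
    Real.norm_of_nonneg (by positivity : 0 ≤ 10 ^ 3 * L)]
  have h4 : L * (β * ‖u.y - u.v‖) ≤ L * (1 / 4 * ‖u.y - u.v‖) := by gcongr
  linarith

theorem norms_le_sqrt_movement (f : EuclideanSpace ℝ (Fin n) → EuclideanSpace ℝ (Fin d) → ℝ)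
    (Y : Set (EuclideanSpace ℝ (Fin d))) (L : ℝ) (w u u' : Iterate n d) :
    ‖u'.x - u.x‖ ≤ √(movement f Y L w u u') ∧ ‖u'.y - u.y‖ ≤ √(movement f Y L w u u') ∧
    ‖u.y - bestResponse f Y L u.x u.v‖ ≤ √(movement f Y L w u u') ∧
    ‖u.x - u.z‖ ≤ √(movement f Y L w u u') ∧ ‖u.x - w.x‖ ≤ √(movement f Y L w u u') ∧
    ‖u.y - w.y‖ ≤ √(movement f Y L w u u') := by
  have := sq_nonneg ‖u'.x - u.x‖
  have := sq_nonneg ‖u'.y - u.y‖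
  have := sq_nonneg ‖u.y - bestResponse f Y L u.x u.v‖
  have := sq_nonneg ‖u.x - u.z‖
  have := sq_nonneg ‖u.x - w.x‖
  have := sq_nonneg ‖u.y - w.y‖
  refine ⟨?_, ?_, ?_, ?_, ?_, ?_⟩ <;> refine Real.le_sqrt_of_sq_le ?_ <;> unfold movement <;>
    linarith

theorem primalResidual_le_sqrt_movement (h : MinimaxProblem f X Y L)
    (hp : ConsecutivePair X Y β w u)
    {u' : Iterate n d} (hu' : u' = dsogdaStep f X Y (stepParams L β) w u) :
    primalResidual f X u'.x u'.y ≤ L * (2 * 10 ^ 9 * √(movement f Y L w u u')) := by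
  refine (h.primalResidual_step_le hp hu' (hu' ▸ h.step_mem_y _ _ hp.cur_y)).trans
    (mul_le_mul_of_nonneg_left ?_ h.pos.le)
  obtain ⟨h1, h2, h3, h4, h5, h6⟩ := norms_le_sqrt_movement f Y L w u u'
  have := norm_nonneg (u'.x - u.x)
  linarith

theorem primalResidual_bestResponse_le_sqrt_movement (h : MinimaxProblem f X Y L)
    (hp : ConsecutivePair X Y β w u)
    {u' : Iterate n d} (hu' : u' = dsogdaStep f X Y (stepParams L β) w u) :
    primalResidual f X u'.x (bestResponse f Y L u'.x u.v) ≤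
      L * (2 * 10 ^ 9 * √(movement f Y L w u u')) := by
  have hx' : u'.x ∈ X := hu' ▸ h.step_mem_x _ _ _
  refine (h.primalResidual_step_le hp hu' (h.bestResponse_mem hx' hp.cur_v)).trans
    (mul_le_mul_of_nonneg_left ?_ h.pos.le)
  obtain ⟨h1, h2, h3, h4, h5, h6⟩ := norms_le_sqrt_movement f Y L w u u'
  have h7 := h.bestResponse_lipschitz hx' hp.cur_x hp.cur_v hp.cur_v
  have h8 : ‖bestResponse f Y L u'.x u.v - u.y‖ ≤ ‖bestResponse f Y L u'.x u.v -
      bestResponse f Y L u.x u.v‖ + ‖u.y - bestResponse f Y L u.x u.v‖ := by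
    rw [norm_sub_rev u.y]
    exact norm_sub_le_norm_sub_add_norm_sub _ _ _
  rw [sub_self, norm_zero, mul_zero, add_zero] at h7
  have := norm_nonneg (u'.x - u.x)
  linarith

/-- The pull towards v leaves ‖y − v‖, which movement does not contain; it is controlled only
through β_y and so limits the rate. -/
theorem dualResidual_le_sqrt_movement (h : MinimaxProblem f X Y L)
    (hp : ConsecutivePair X Y β w u) (hβ : 0 < β) (hβ' : β ≤ 1 / 4)
    {u' : Iterate n d} (hu' : u' = dsogdaStep f X Y (stepParams L β) w u) :
    dualResidual f Y u'.x u'.y ≤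
      L * (2 * 10 ^ 9 * √(movement f Y L w u u') + 3 * ‖u.y - u.v‖) := by
  refine (h.dualResidual_step_le hp hβ hβ' hu').trans (mul_le_mul_of_nonneg_left ?_ h.pos.le)
  obtain ⟨h1, h2, h3, h4, h5, h6⟩ := norms_le_sqrt_movement f Y L w u u'
  have := Real.sqrt_nonneg (movement f Y L w u u')
  linarith

/-- The gap of the primal problem is controlled by the movement under an error bound. -/
theorem gap_rpow_le (h : MinimaxProblem f X Y L) (hp : ConsecutivePair X Y β w u)
    {u' : Iterate n d} (hu' : u' = dsogdaStep f X Y (stepParams L β) w u) {θ c : ℝ} (hθ : 0 < θ)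
    (hc : 0 ≤ c)
    (hKL : ∀ x ∈ X, ∀ y ∈ Y, (f x y - primalMin f X y) ^ θ ≤ c * primalResidual f X x y) :
    (smoothedMax f Y L u'.x u.v - envelope f X Y L u.v) ^ θ ≤
      c * L * (2 * 10 ^ 9) * √(movement f Y L w u u') := by
  have hx' : u'.x ∈ X := hu' ▸ h.step_mem_x _ _ _
  have h1 := h.smoothedMax_sub_envelope_le hx' hp.cur_v
  have h2 := h.envelope_le_smoothedMax hx' hp.cur_v
  -- The error bound is used at the best response to the new x with the old center, not at a dual
  -- iterate.
  have h3 := hKL _ hx' _ (h.bestResponse_mem hx' hp.cur_v)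
  have h4 := h.primalResidual_bestResponse_le_sqrt_movement hp hu'
  calc _ ≤ _ := Real.rpow_le_rpow (sub_nonneg.2 h2) h1 hθ.le
    _ ≤ _ := h3
    _ ≤ c * (L * (2 * 10 ^ 9 * √(movement f Y L w u u'))) := mul_le_mul_of_nonneg_left h4 hc
    _ = _ := by ring

theorem movement_le (h : MinimaxProblem f X Y L) (hp : ConsecutivePair X Y β w u)
    {u' : Iterate n d} (hu' : u' = dsogdaStep f X Y (stepParams L β) w u) {D : ℝ}
    (hY : IsCompact Y) (hXD : Metric.diam X ≤ D) (hYD : Metric.diam Y ≤ D) :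
    movement f Y L w u u' ≤ 6 * D ^ 2 := by
  have hx' : u'.x ∈ X := hu' ▸ h.step_mem_x _ _ _
  have hy' : u'.y ∈ Y := hu' ▸ h.step_mem_y _ _ hp.cur_y
  have hx : ∀ a ∈ X, ∀ b ∈ X, ‖a - b‖ ^ 2 ≤ D ^ 2 := fun a ha b hb =>
    pow_le_pow_left₀ (norm_nonneg _) (by
      rw [← dist_eq_norm]
      exact (Metric.dist_le_diam_of_mem h.compactX.isBounded ha hb).trans hXD) 2
  have hy : ∀ a ∈ Y, ∀ b ∈ Y, ‖a - b‖ ^ 2 ≤ D ^ 2 := fun a ha b hb =>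
    pow_le_pow_left₀ (norm_nonneg _) (by
      rw [← dist_eq_norm]
      exact (Metric.dist_le_diam_of_mem hY.isBounded ha hb).trans hYD) 2
  have := hx _ hx' _ hp.cur_x
  have := hy _ hy' _ hp.cur_y
  have := hy _ hp.cur_y _ (h.bestResponse_mem hp.cur_x hp.cur_v)
  have := hx _ hp.cur_x _ hp.cur_z
  have := hx _ hp.cur_x _ hp.prev_x
  have := hy _ hp.cur_y _ hp.prev_y
  unfold movement
  linarith

/-- The error bound with exponent `1` for convex problems on a compact set. -/
theorem sub_primalMin_le_of_convexOn (h : MinimaxProblem f X Y L)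
    {x : EuclideanSpace ℝ (Fin n)} {y : EuclideanSpace ℝ (Fin d)} (hx : x ∈ X)
    (hconv : ConvexOn ℝ Set.univ fun x => f x y) :
    f x y - primalMin f X y ≤ Metric.diam X * primalResidual f X x y := by
  have hc : Continuous fun x => f x y := h.continuous.comp (.prodMk_left y)
  obtain ⟨xs, hxs, hmin⟩ := h.compactX.exists_sInf_image_eq h.nonemptyX hc.continuousOn
  have h1 : primalMin f X y = f xs y := hmin
  have h2 := ConvexOn.inner_gradient_le (fun x => h.hasGradientAt_fst x y) hconv x xs
  rw [h1]
  have hd : ‖xs - x‖ ≤ Metric.diam X := by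
    rw [← dist_eq_norm]
    exact Metric.dist_le_diam_of_mem h.compactX.isBounded hxs hx
  have key : ∀ g ∈ indicatorSubdifferential X x,
      f x y - f xs y ≤ Metric.diam X * ‖gradX f x y + g‖ := by
    intro g hg
    have h3 := hg xs hxs
    have h4 := (neg_le_abs _).trans (abs_real_inner_le_norm (gradX f x y + g) (xs - x))
    rw [inner_add_left] at h4
    have h5 := mul_le_mul_of_nonneg_left hd (norm_nonneg (gradX f x y + g))
    linarith
  have hne : ((fun g => gradX f x y + g) '' indicatorSubdifferential X x).Nonempty :=
    ⟨_, 0, fun q _ => by simp, rfl⟩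
  -- Dividing by the diameter requires it to be positive; a one-point X is settled by the zero
  -- normal vector.
  rcases (Metric.diam_nonneg (s := X)).eq_or_lt with h0 | h0
  · have := key 0 fun q _ => by simp
    rw [← h0, zero_mul] at this ⊢
    exact this
  · rw [← div_le_iff₀' h0]
    refine (Metric.le_infDist hne).2 ?_
    rintro _ ⟨g, hg, rfl⟩
    rw [dist_zero_left, div_le_iff₀' h0]
    exact key g hg

theorem consecutivePair_dsogdaPair (h : MinimaxProblem f X Y L)
    {x₀ : EuclideanSpace ℝ (Fin n)} {y₀ : EuclideanSpace ℝ (Fin d)} (hx₀ : x₀ ∈ X) (hy₀ : y₀ ∈ Y)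
    (hβ : 0 < β) (hβ' : β ≤ 1) (t : ℕ) :
    ConsecutivePair X Y β (dsogdaPair f X Y (stepParams L β) x₀ y₀ t).1
      (dsogdaPair f X Y (stepParams L β) x₀ y₀ t).2 := by
  induction t with
  | zero => exact ⟨hx₀, hy₀, hx₀, hy₀, hx₀, hy₀, by simp [dsogdaPair], by simp [dsogdaPair]⟩
  | succ t ih => exact h.consecutivePair_step ih hβ hβ'

/-- Averaging the decrease of the Lyapunov function: some iterate moves little. -/
theorem exists_small_movement (h : MinimaxProblem f X Y L)
    {x₀ : EuclideanSpace ℝ (Fin n)} {y₀ : EuclideanSpace ℝ (Fin d)} (hx₀ : x₀ ∈ X)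
    (hy₀ : y₀ ∈ Y) :
    ∃ K : ℝ, 0 ≤ K ∧ ∀ β : ℝ, 0 < β → β ≤ 1 / 10 ^ 10 → ∀ T : ℕ, 0 < T → ∀ c : ℝ,
      (∀ w u u' : Iterate n d, ConsecutivePair X Y β w u →
        u' = dsogdaStep f X Y (stepParams L β) w u →
        16 * β * (smoothedMax f Y L u'.x u.v - envelope f X Y L u.v) ≤
          L / 2 * movement f Y L w u u' + c / T) →
      ∃ t < T, ∃ w u u' : Iterate n d, ConsecutivePair X Y β w u ∧
        u' = dsogdaStep f X Y (stepParams L β) w u ∧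
        u' = dsogda f X Y (stepParams L β) x₀ y₀ (t + 1) ∧
        L / 2 * movement f Y L w u u' + L / 4 * β * ‖u.y - u.v‖ ^ 2 ≤ (K + c) / T := by
  have hL := h.pos
  obtain ⟨M, hM⟩ := h.exists_envelope_le
  set V₀ := lyapunov f X Y L ⟨x₀, y₀, x₀, y₀⟩ ⟨x₀, y₀, x₀, y₀⟩ with hV₀
  -- Were every step to decrease the potential by K/T, it would end at V₀ − K ≤ −M − 1, below its
  -- bound −M. The initial potential involves neither β nor T, so K is uniform in both.
  refine ⟨max 0 (V₀ + M) + 1, by positivity, fun β hβ hβ' T hT c hgap => ?_⟩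
  set K := max 0 (V₀ + M) + 1 with hK
  by_contra! hcon
  have hT' : (0 : ℝ) < T := by exact_mod_cast hT
  set p := dsogdaPair f X Y (stepParams L β) x₀ y₀ with hpdef
  have hp : ∀ t, ConsecutivePair X Y β (p t).1 (p t).2 :=
    h.consecutivePair_dsogdaPair hx₀ hy₀ hβ (hβ'.trans (by norm_num))
  have hs1 : ∀ t, (p (t + 1)).1 = (p t).2 := fun t => rfl
  have hs2 : ∀ t, (p (t + 1)).2 = dsogdaStep f X Y (stepParams L β) (p t).1 (p t).2 :=
    fun t => rfl
  have hdec : ∀ t ≤ T, lyapunov f X Y L (p t).1 (p t).2 ≤ V₀ - t * (K / T) := by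
    intro t
    induction t with
    | zero => intro _; simp [hV₀, hpdef, dsogdaPair]
    | succ t ih =>
      intro ht
      have h1 := ih (by omega)
      have h2 := h.lyapunov_step (hp t) hβ hβ' (hs2 t)
      have h3 := hgap _ _ _ (hp t) (hs2 t)
      have h4 := hcon t (by omega) _ _ _ (hp t) (hs2 t) rfl
      rw [add_div] at h4
      rw [hs1 t]
      push_cast
      linarith
  have h1 := hdec T le_rfl
  rw [mul_div_cancel₀ _ hT'.ne'] at h1
  have h2 := h.envelope_le_smoothedMax (hp T).cur_x (hp T).cur_v
  have h3 := hM _ (hp T).cur_v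
  have h4 : smoothedMax f Y L (p T).2.x (p T).2.v - 2 * envelope f X Y L (p T).2.v ≤
      lyapunov f X Y L (p T).1 (p T).2 := by
    unfold lyapunov
    exact le_add_of_nonneg_right (by positivity)
  have h5 := le_max_right 0 (V₀ + M)
  linarith

end MinimaxProblem

/-! ### Absorbing the gap and scheduling the dual smoothing parameter -/

/-- A quantity bounded by a power at least `1/θ ≥ 1` of `√S` is absorbed by `S` up to a power of
the small factor in front of it. -/
theorem mul_le_absorb_add_rpow {θ L A g S β : ℝ} (hθ : 1 / 2 < θ) (hL : 0 < L) (hA : 0 ≤ A)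
    (hg : 0 ≤ g) (hβ : 0 < β) (hS : 0 ≤ S) (h : g ^ θ ≤ A * √S) :
    16 * β * g ≤ L / 2 * S +
      16 * (A * √(32 / L)) ^ (1 / (θ - 1 / 2)) * β ^ (2 * θ / (2 * θ - 1)) := by
  have hθ' : 0 < θ - 1 / 2 := by linarith
  have hrhs : 0 ≤ 16 * (A * √(32 / L)) ^ (1 / (θ - 1 / 2)) * β ^ (2 * θ / (2 * θ - 1)) := by
    positivity
  -- If S does not already dominate, then S ≤ (32/L)βg; reinserting this in the hypothesis leaves
  -- g^{θ − 1/2} ≤ const·β^{1/2}, which can be solved for g.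
  rcases le_or_gt (16 * β * g) (L / 2 * S) with h1 | h1
  · linarith
  have hg' : 0 < g := by
    rcases hg.eq_or_lt with h0 | h0
    · rw [← h0, mul_zero] at h1
      exact absurd h1 (not_lt.2 (by positivity))
    · exact h0
  have hSle : S ≤ 32 / L * (β * g) := by
    rw [div_mul_eq_mul_div, le_div_iff₀ hL]
    linarith
  have h2 : g ^ θ ≤ A * √(32 / L) * β ^ (1 / 2 : ℝ) * g ^ (1 / 2 : ℝ) := by
    calc g ^ θ ≤ A * √S := h
      _ ≤ A * √(32 / L * (β * g)) := by gcongr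
      _ = _ := by
        rw [Real.sqrt_mul (by positivity), Real.sqrt_mul hβ.le, ← Real.sqrt_eq_rpow,
          ← Real.sqrt_eq_rpow]
        ring
  have h3 : g ^ (θ - 1 / 2) ≤ A * √(32 / L) * β ^ (1 / 2 : ℝ) := by
    rw [Real.rpow_sub hg', div_le_iff₀ (by positivity)]
    exact h2
  have h4 : g ≤ (A * √(32 / L)) ^ (1 / (θ - 1 / 2)) * β ^ (1 / (2 * θ - 1)) := by
    have h5 := Real.rpow_le_rpow (by positivity) h3 (show 0 ≤ 1 / (θ - 1 / 2) by positivity)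
    rw [← Real.rpow_mul hg, mul_one_div_cancel hθ'.ne', Real.rpow_one,
      Real.mul_rpow (by positivity) (by positivity), ← Real.rpow_mul hβ.le] at h5
    have e : (1 / 2 : ℝ) * (1 / (θ - 1 / 2)) = 1 / (2 * θ - 1) := by
      have : 2 * θ - 1 ≠ 0 := by linarith
      field_simp
    rwa [e] at h5
  have e2 : β ^ (2 * θ / (2 * θ - 1)) = β * β ^ (1 / (2 * θ - 1)) := by
    have h0 : 2 * θ - 1 ≠ 0 := by linarith
    rw [← Real.rpow_one_add' hβ.le (by
      have : 0 < 1 / (2 * θ - 1) := one_div_pos.2 (by linarith)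
      linarith)]
    congr 1
    field_simp
    ring
  rw [e2]
  have h6 := mul_le_mul_of_nonneg_left h4 (show 0 ≤ 16 * β by positivity)
  have h7 : 0 ≤ L / 2 * S := by positivity
  linarith

/-- Here 1/(2θ) ≥ 1, so g ≤ A^{1/θ}S^{1/(2θ)} is linear in S once the excess power is bounded by B.
-/
theorem le_mul_of_rpow_le {θ A g S B : ℝ} (hθ : 0 < θ) (hθ' : θ ≤ 1 / 2) (hA : 0 ≤ A)
    (hg : 0 ≤ g) (hS : 0 ≤ S) (hSB : S ≤ B) (h : g ^ θ ≤ A * √S) :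
    g ≤ A ^ (1 / θ) * B ^ (1 / (2 * θ) - 1) * S := by
  have h1 := Real.rpow_le_rpow (by positivity) h (show 0 ≤ 1 / θ by positivity)
  rw [← Real.rpow_mul hg, mul_one_div_cancel hθ.ne', Real.rpow_one,
    Real.mul_rpow hA (Real.sqrt_nonneg _), Real.sqrt_eq_rpow, ← Real.rpow_mul hS] at h1
  have hexp : 0 ≤ 1 / (2 * θ) - 1 := by
    rw [sub_nonneg, le_div_iff₀ (by positivity)]
    linarith
  have e : (1 / 2 : ℝ) * (1 / θ) = (1 / (2 * θ) - 1) + 1 := by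
    field_simp
    ring
  rw [e, Real.rpow_add_one' hS (by linarith)] at h1
  calc g ≤ _ := h1
    _ ≤ A ^ (1 / θ) * (B ^ (1 / (2 * θ) - 1) * S) := by gcongr
    _ = _ := by ring

theorem stepParams_admissible {L β : ℝ} (hL : 0 < L) (hβ : 0 < β) (hβ' : β ≤ 1 / 10 ^ 10) :
    (stepParams L β).Admissible (2 * L + 1 / L + 1) := by
  have h1 : 0 < 1 / L := by positivity
  have h2 : 1 / (10 ^ 9 * L) ≤ 1 / L := one_div_le_one_div_of_le hL (by linarith)
  have h3 : 1 / (10 ^ 3 * L) ≤ 1 / L := one_div_le_one_div_of_le hL (by linarith)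
  have h4 : (1 : ℝ) / 10 ^ 10 < 1 / 2 := by norm_num
  have h5 : 0 < 1 / (10 ^ 9 * L) := by positivity
  have h6 : 0 < 1 / (10 ^ 3 * L) := by positivity
  simp only [Params.Admissible, stepParams]
  refine ⟨⟨?_, ?_⟩, ⟨?_, ?_⟩, ⟨?_, ?_⟩, ⟨?_, ?_⟩, ⟨?_, ?_, ?_⟩, ⟨?_, ?_, ?_⟩⟩ <;> linarith

/-- The choice of parameters with `β_y = β T^{γ - 1}`. -/
def scheduledParams (L β γ : ℝ) (T : ℕ) : Params := stepParams L (β * (T : ℝ) ^ (γ - 1))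

theorem schedule_bounds {β γ : ℝ} (hβ : 0 < β) (hγ : γ ≤ 1) {T : ℕ} (hT : 1 < T) :
    0 < β * (T : ℝ) ^ (γ - 1) ∧ β * (T : ℝ) ^ (γ - 1) ≤ β := by
  have hT' : (1 : ℝ) < T := by exact_mod_cast hT
  have h1 : (T : ℝ) ^ (γ - 1) ≤ 1 := Real.rpow_le_one_of_one_le_of_nonpos hT'.le (by linarith)
  have h2 : 0 < (T : ℝ) ^ (γ - 1) := Real.rpow_pos_of_pos (by linarith) _
  exact ⟨by positivity, by nlinarith⟩

theorem scheduledParams_admissible {L β γ : ℝ} (hL : 0 < L) (hβ : 0 < β) (hβ' : β ≤ 1 / 10 ^ 10)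
    (hγ : γ ≤ 1) {T : ℕ} (hT : 1 < T) :
    (scheduledParams L β γ T).Admissible (2 * L + 1 / L + 1) ∧
      (scheduledParams L β γ T).βy ≤ (2 * L + 1 / L + 1) * (T : ℝ) ^ (γ - 1) := by
  obtain ⟨h1, h2⟩ := schedule_bounds hβ hγ hT
  refine ⟨stepParams_admissible hL h1 (h2.trans hβ'), mul_le_mul_of_nonneg_right ?_ (by positivity)⟩
  have : 0 < 1 / L := by positivity
  have : (1 : ℝ) / 10 ^ 10 < 1 / 2 := by norm_num
  linarith

/-- The initial value of `β_y` for an error bound with exponent at most `1/2`. -/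
def smallExponentStep (L τ θ D : ℝ) : ℝ :=
  min (1 / 10 ^ 10) (L / (32 * ((1 / τ * L * (2 * 10 ^ 9)) ^ (1 / θ) *
    (6 * D ^ 2) ^ (1 / (2 * θ) - 1) + 1)))

theorem smallExponentStep_pos {L τ θ D : ℝ} (hL : 0 < L) (hτ : 0 < τ) :
    0 < smallExponentStep L τ θ D := by
  unfold smallExponentStep
  positivity

/-! ### Convergence rates -/

namespace MinimaxProblem

variable {n d : ℕ} {f : EuclideanSpace ℝ (Fin n) → EuclideanSpace ℝ (Fin d) → ℝ}
  {X : Set (EuclideanSpace ℝ (Fin n))} {Y : Set (EuclideanSpace ℝ (Fin d))} {L β : ℝ}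

/-- The rate of DS-OGDA when the gap of the primal problem is absorbed by the movement up to
`c / T`. -/
theorem exists_isGameStationary (h : MinimaxProblem f X Y L) {β γ c : ℝ} (hβ : 0 < β)
    (hβ' : β ≤ 1 / 10 ^ 10) (hγ : γ ≤ 1) (hc : 0 ≤ c)
    (hgap : ∀ T : ℕ, 1 < T → ∀ w u u' : Iterate n d,
      ConsecutivePair X Y (β * (T : ℝ) ^ (γ - 1)) w u →
      u' = dsogdaStep f X Y (scheduledParams L β γ T) w u →
      16 * (β * (T : ℝ) ^ (γ - 1)) * (smoothedMax f Y L u'.x u.v - envelope f X Y L u.v) ≤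
        L / 2 * movement f Y L w u u' + c / T)
    {x₀ : EuclideanSpace ℝ (Fin n)} {y₀ : EuclideanSpace ℝ (Fin d)} (hx₀ : x₀ ∈ X)
    (hy₀ : y₀ ∈ Y) :
    ∃ K : ℝ, ∀ T : ℕ, 1 < T → ∃ t < T, IsGameStationary f X Y (K * (T : ℝ) ^ (-(γ / 2)))
      (dsogda f X Y (scheduledParams L β γ T) x₀ y₀ (t + 1)).x
      (dsogda f X Y (scheduledParams L β γ T) x₀ y₀ (t + 1)).y := by
  have hL := h.pos
  obtain ⟨K, hK, hmain⟩ := h.exists_small_movement hx₀ hy₀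
  refine ⟨L * (2 * 10 ^ 9 * √(2 * (K + c) / L) + 3 * √(4 * (K + c) / (L * β))), fun T hT => ?_⟩
  have hT1 : (1 : ℝ) < T := by exact_mod_cast hT
  have hT0 : (0 : ℝ) < T := by linarith
  obtain ⟨hb0, hb1⟩ := schedule_bounds hβ hγ hT
  obtain ⟨t, ht, w, u, u', hp, hstep, hu', hle⟩ :=
    hmain _ hb0 (hb1.trans hβ') T (by omega) c (hgap T hT)
  refine ⟨t, ht, ?_⟩
  rw [scheduledParams, ← hu']
  set S := movement f Y L w u u' with hSdef
  have hS : 0 ≤ S := movement_nonneg f Y L w u u'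
  have hTγ : 0 < (T : ℝ) ^ (-γ) := Real.rpow_pos_of_pos hT0 _
  -- The movement is O(1/T), but the slower T^{−γ} suffices, since ‖y − v‖² is no better than that.
  have hTinv : 1 / (T : ℝ) ≤ (T : ℝ) ^ (-γ) := by
    rw [one_div, ← Real.rpow_neg_one]
    exact Real.rpow_le_rpow_of_exponent_le hT1.le (by linarith)
  have hsq : √((T : ℝ) ^ (-γ)) = (T : ℝ) ^ (-(γ / 2)) := by
    rw [Real.sqrt_eq_rpow, ← Real.rpow_mul hT0.le]
    congr 1
    ring
  have hKc : 0 ≤ K + c := by linarith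
  have hS1 : √S ≤ √(2 * (K + c) / L) * (T : ℝ) ^ (-(γ / 2)) := by
    rw [← hsq, ← Real.sqrt_mul (by positivity)]
    refine Real.sqrt_le_sqrt ?_
    have h1 : L / 2 * S ≤ (K + c) / T :=
      le_trans (le_add_of_nonneg_right (by positivity)) hle
    have h2 : (K + c) / T ≤ (K + c) * (T : ℝ) ^ (-γ) := by
      rw [div_eq_mul_one_div]
      exact mul_le_mul_of_nonneg_left hTinv hKc
    rw [div_mul_eq_mul_div, le_div_iff₀ hL]
    linarith
  -- The weight β_y in the averaged bound gives ‖y − v‖² = O(1/(Tβ_y)), and Tβ_y = βT^γ.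
  have hN1 : ‖u.y - u.v‖ ≤ √(4 * (K + c) / (L * β)) * (T : ℝ) ^ (-(γ / 2)) := by
    rw [← hsq, ← Real.sqrt_mul (by positivity)]
    refine Real.le_sqrt_of_sq_le ?_
    have h1 : L / 4 * (β * (T : ℝ) ^ (γ - 1)) * ‖u.y - u.v‖ ^ 2 ≤ (K + c) / T :=
      le_trans (le_add_of_nonneg_left (by positivity)) hle
    have h2 : (T : ℝ) ^ (γ - 1) * T = (T : ℝ) ^ γ := by
      rw [Real.rpow_sub_one hT0.ne']
      field_simp
    have h3 : (T : ℝ) ^ γ * (T : ℝ) ^ (-γ) = 1 := by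
      rw [← Real.rpow_add hT0, add_neg_cancel, Real.rpow_zero]
    rw [le_div_iff₀ hT0] at h1
    have h4 : L / 4 * β * (T : ℝ) ^ γ * ‖u.y - u.v‖ ^ 2 ≤ K + c := by
      rw [← h2]
      linarith
    have h5 := mul_le_mul_of_nonneg_right h4 hTγ.le
    rw [div_mul_eq_mul_div, le_div_iff₀ (by positivity)]
    have h6 : L / 4 * β * (T : ℝ) ^ γ * ‖u.y - u.v‖ ^ 2 * (T : ℝ) ^ (-γ) =
        L / 4 * β * ‖u.y - u.v‖ ^ 2 * ((T : ℝ) ^ γ * (T : ℝ) ^ (-γ)) := by ring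
    rw [h6, h3] at h5
    linarith
  have hx' : u'.x ∈ X := hstep ▸ h.step_mem_x _ _ _
  have hy' : u'.y ∈ Y := hstep ▸ h.step_mem_y _ _ hp.cur_y
  have hb4 : β * (T : ℝ) ^ (γ - 1) ≤ 1 / 4 := (hb1.trans hβ').trans (by norm_num)
  have r1 := h.primalResidual_le_sqrt_movement hp hstep
  have r2 := h.dualResidual_le_sqrt_movement hp hb0 hb4 hstep
  have r3 : L * (2 * 10 ^ 9 * √S + 3 * ‖u.y - u.v‖) ≤
      L * (2 * 10 ^ 9 * √(2 * (K + c) / L) + 3 * √(4 * (K + c) / (L * β))) *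
        (T : ℝ) ^ (-(γ / 2)) := by
    rw [mul_assoc L]
    refine mul_le_mul_of_nonneg_left ?_ hL.le
    linarith
  refine ⟨hx', hy', le_trans (r1.trans (mul_le_mul_of_nonneg_left ?_ hL.le)) r3, r2.trans r3⟩
  have := norm_nonneg (u.y - u.v)
  linarith

/-- The rate of DS-OGDA under an error bound with exponent above `1/2`. -/
theorem exists_isGameStationary_of_half_lt (h : MinimaxProblem f X Y L) {θ c : ℝ}
    (hθ : 1 / 2 < θ) (hc : 0 ≤ c)
    (hKL : ∀ x ∈ X, ∀ y ∈ Y, (f x y - primalMin f X y) ^ θ ≤ c * primalResidual f X x y)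
    {x₀ : EuclideanSpace ℝ (Fin n)} {y₀ : EuclideanSpace ℝ (Fin d)} (hx₀ : x₀ ∈ X)
    (hy₀ : y₀ ∈ Y) :
    ∃ K : ℝ, ∀ T : ℕ, 1 < T → ∃ t < T,
      IsGameStationary f X Y (K * (T : ℝ) ^ (-(1 / (2 * θ) / 2)))
        (dsogda f X Y (scheduledParams L (1 / 10 ^ 10) (1 / (2 * θ)) T) x₀ y₀ (t + 1)).x
        (dsogda f X Y (scheduledParams L (1 / 10 ^ 10) (1 / (2 * θ)) T) x₀ y₀ (t + 1)).y := by
  have hL := h.pos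
  have hγ : 1 / (2 * θ) ≤ 1 := by
    rw [div_le_one (by linarith)]
    linarith
  refine h.exists_isGameStationary
    (c := 16 * (c * L * (2 * 10 ^ 9) * √(32 / L)) ^ (1 / (θ - 1 / 2)) *
      (1 / 10 ^ 10 : ℝ) ^ (2 * θ / (2 * θ - 1)))
    (by norm_num) le_rfl hγ (by positivity) (fun T hT w u u' hp hstep => ?_) hx₀ hy₀
  have hT0 : (0 : ℝ) < T := by exact_mod_cast (by omega : 0 < T)
  obtain ⟨hb0, hb1⟩ := schedule_bounds (show (0 : ℝ) < 1 / 10 ^ 10 by norm_num) hγ hT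
  have hx' : u'.x ∈ X := hstep ▸ h.step_mem_x _ _ _
  have h1 := h.gap_rpow_le hp hstep (by linarith) hc hKL
  have h2 := mul_le_absorb_add_rpow hθ hL (by positivity)
    (sub_nonneg.2 (h.envelope_le_smoothedMax hx' hp.cur_v)) hb0 (movement_nonneg f Y L w u u') h1
  refine h2.trans (le_of_eq ?_)
  rw [Real.mul_rpow (x := 1 / 10 ^ 10) (by norm_num) (by positivity), ← Real.rpow_mul hT0.le]
  -- The choice γ = 1/(2θ) makes the remainder β_y^{2θ/(2θ−1)} exactly of order 1/T.
  have e : (1 / (2 * θ) - 1) * (2 * θ / (2 * θ - 1)) = -1 := by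
    have : 2 * θ - 1 ≠ 0 := by linarith
    have : θ ≠ 0 := by linarith
    field_simp
    ring
  rw [e, Real.rpow_neg_one]
  ring

/-- The rate of DS-OGDA under an error bound with exponent at most `1/2`. -/
theorem exists_isGameStationary_of_le_half (h : MinimaxProblem f X Y L) {θ τ D : ℝ}
    (hθ : 0 < θ) (hθ' : θ ≤ 1 / 2) (hτ : 0 < τ)
    (hY : IsCompact Y) (hXD : Metric.diam X ≤ D) (hYD : Metric.diam Y ≤ D)
    (hKL : ∀ x ∈ X, ∀ y ∈ Y, (f x y - primalMin f X y) ^ θ ≤ 1 / τ * primalResidual f X x y)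
    {x₀ : EuclideanSpace ℝ (Fin n)} {y₀ : EuclideanSpace ℝ (Fin d)} (hx₀ : x₀ ∈ X)
    (hy₀ : y₀ ∈ Y) :
    ∃ K : ℝ, ∀ T : ℕ, 1 < T → ∃ t < T, IsGameStationary f X Y (K * (T : ℝ) ^ (-(1 / 2 : ℝ)))
        (dsogda f X Y (scheduledParams L (smallExponentStep L τ θ D) 1 T) x₀ y₀ (t + 1)).x
        (dsogda f X Y (scheduledParams L (smallExponentStep L τ θ D) 1 T) x₀ y₀ (t + 1)).y := by
  have hL := h.pos
  have hβ := smallExponentStep_pos (θ := θ) (D := D) hL hτ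
  refine h.exists_isGameStationary (c := 0) hβ (min_le_left _ _) le_rfl le_rfl
    (fun T hT w u u' hp hstep => ?_) hx₀ hy₀
  have hx' : u'.x ∈ X := hstep ▸ h.step_mem_x _ _ _
  have hS := movement_nonneg f Y L w u u'
  have h1 := h.gap_rpow_le hp hstep hθ (by positivity) hKL
  have h2 := le_mul_of_rpow_le hθ hθ' (by positivity)
    (sub_nonneg.2 (h.envelope_le_smoothedMax hx' hp.cur_v)) hS
    (h.movement_le hp hstep hY hXD hYD) h1
  have h3 : smallExponentStep L τ θ D ≤ L / (32 * ((1 / τ * L * (2 * 10 ^ 9)) ^ (1 / θ) *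
    (6 * D ^ 2) ^ (1 / (2 * θ) - 1) + 1)) := min_le_right _ _
  have hB : 0 ≤ (1 / τ * L * (2 * 10 ^ 9)) ^ (1 / θ) * (6 * D ^ 2) ^ (1 / (2 * θ) - 1) := by
    positivity
  generalize (1 / τ * L * (2 * 10 ^ 9)) ^ (1 / θ) * (6 * D ^ 2) ^ (1 / (2 * θ) - 1) = B at *
  generalize smallExponentStep L τ θ D = β at *
  -- This becomes 32β(B + 1) ≤ L, hence 16βB ≤ L/2 and no remainder; the +1 keeps the denominator
  -- positive.
  rw [le_div_iff₀ (by positivity)] at h3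
  rw [sub_self, Real.rpow_zero, mul_one, zero_div, add_zero]
  have h4 := mul_le_mul_of_nonneg_left h2 (show 0 ≤ 16 * β by positivity)
  have h5 := mul_le_mul_of_nonneg_right h3 hS
  have h6 : 0 ≤ β * movement f Y L w u u' := by positivity
  linarith

end MinimaxProblem

end

/-! ### Assembly of the two cases -/

theorem corollary1 :
    -- (i) convex primal
    (∀ L : ℝ, 0 < L →
      ∃ (P : ℕ → Params) (C : ℝ),
        (∀ T : ℕ, 1 < T → (P T).Admissible C ∧ (P T).βy ≤ C * (T : ℝ) ^ (-(1 / 2 : ℝ))) ∧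
        ∀ (n d : ℕ) (X : Set (EuclideanSpace ℝ (Fin n))) (Y : Set (EuclideanSpace ℝ (Fin d)))
          (f : EuclideanSpace ℝ (Fin n) → EuclideanSpace ℝ (Fin d) → ℝ),
          IsCompact X → Convex ℝ X → IsClosed Y → Convex ℝ Y →
          SmoothObjective f X Y L →
          (∀ y ∈ Y, ConvexOn ℝ Set.univ (fun x => f x y)) →
          BddAbove (primalMin f X '' Y) →
          ∀ x₀ ∈ X, ∀ y₀ ∈ Y, ∃ K : ℝ, ∀ T : ℕ, 1 < T → ∃ t < T,
            IsGameStationary f X Y (K * (T : ℝ) ^ (-(1 / 4 : ℝ)))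
              (dsogda f X Y (P T) x₀ y₀ (t + 1)).x (dsogda f X Y (P T) x₀ y₀ (t + 1)).y) ∧
    -- (ii) Kurdyka-Łojasiewicz primal
    (∀ L τ θ D : ℝ, 0 < L → 0 < τ → 0 < θ → θ < 1 →
      ∃ (P : ℕ → Params) (C : ℝ),
        (∀ T : ℕ, 1 < T → (P T).Admissible C ∧
          (P T).βy ≤ C * (T : ℝ) ^ (-(max (2 * θ - 1) 0 / (2 * θ)))) ∧
        ∀ (n d : ℕ) (X : Set (EuclideanSpace ℝ (Fin n))) (Y : Set (EuclideanSpace ℝ (Fin d)))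
          (f : EuclideanSpace ℝ (Fin n) → EuclideanSpace ℝ (Fin d) → ℝ),
          IsCompact X → Convex ℝ X → IsCompact Y → Convex ℝ Y →
          Metric.diam X ≤ D → Metric.diam Y ≤ D →
          SmoothObjective f X Y L →
          PrimalKL f X Y τ θ →
          ∀ x₀ ∈ X, ∀ y₀ ∈ Y, ∃ K : ℝ, ∀ T : ℕ, 1 < T → ∃ t < T,
            IsGameStationary f X Y (K * (T : ℝ) ^ (-(1 / (max (4 * θ - 2) 0 + 2))))
              (dsogda f X Y (P T) x₀ y₀ (t + 1)).x (dsogda f X Y (P T) x₀ y₀ (t + 1)).y) := by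
  refine ⟨fun L hL => ?_, fun L τ θ D hL hτ hθ hθ1 => ?_⟩
  -- The convex case is the error bound with θ = 1. Its constant, the diameter of X, enters only the
  -- rate constant and not the parameters.
  · refine ⟨scheduledParams L (1 / 10 ^ 10) (1 / (2 * 1)), 2 * L + 1 / L + 1, fun T hT => ?_,
      fun n d X Y f hX hXc hY hYc hf hconv hbdd x₀ hx₀ y₀ hy₀ => ?_⟩
    · have := scheduledParams_admissible (γ := 1 / (2 * 1)) hL (by norm_num) le_rfl
        (by norm_num) hT
      rwa [show (1 / (2 * 1) - 1 : ℝ) = -(1 / 2) by norm_num] at this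
    · have h : MinimaxProblem f X Y L := ⟨hL, hX, hXc, ⟨x₀, hx₀⟩, hY, hYc, hf, hbdd⟩
      have := h.exists_isGameStationary_of_half_lt (θ := 1) (by norm_num) Metric.diam_nonneg
        (fun x hx y hy => by
          rw [Real.rpow_one]
          exact h.sub_primalMin_le_of_convexOn hx (hconv y hy)) hx₀ hy₀
      rwa [show (-(1 / (2 * 1) / 2) : ℝ) = -(1 / 4) by norm_num] at this
  · have problem : ∀ (n d : ℕ) (X : Set (EuclideanSpace ℝ (Fin n)))
        (Y : Set (EuclideanSpace ℝ (Fin d)))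
        (f : EuclideanSpace ℝ (Fin n) → EuclideanSpace ℝ (Fin d) → ℝ),
        IsCompact X → Convex ℝ X → IsCompact Y → Convex ℝ Y → SmoothObjective f X Y L →
        ∀ x₀ ∈ X, MinimaxProblem f X Y L := by
      intro n d X Y f hX hXc hY hYc hf x₀ hx₀
      refine ⟨hL, hX, hXc, ⟨x₀, hx₀⟩, hY.isClosed, hYc, hf, ?_⟩
      -- The primal value is at most f(x₀,·), which is bounded on compact Y.
      have hcont : Continuous fun y => f x₀ y := hf.1.continuous.comp (Continuous.prodMk_right x₀)
      obtain ⟨M, hM⟩ := hY.bddAbove_image hcont.continuousOn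
      refine ⟨M, ?_⟩
      rintro _ ⟨y, hy, rfl⟩
      refine le_trans (csInf_le (hX.bddBelow_image ?_) ⟨x₀, hx₀, rfl⟩) (hM ⟨y, hy, rfl⟩)
      exact (hf.1.continuous.comp (Continuous.prodMk_left y)).continuousOn
    rcases le_or_gt θ (1 / 2) with hθ2 | hθ2
    · refine ⟨scheduledParams L (smallExponentStep L τ θ D) 1, 2 * L + 1 / L + 1, fun T hT => ?_,
        fun n d X Y f hX hXc hY hYc hXD hYD hf hKL x₀ hx₀ y₀ hy₀ => ?_⟩
      · have := scheduledParams_admissible (γ := 1) hL (smallExponentStep_pos hL hτ)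
          (min_le_left _ _ : smallExponentStep L τ θ D ≤ _) le_rfl hT
        rwa [max_eq_right (by linarith), zero_div, neg_zero, ← sub_self (1 : ℝ)]
      · have h := problem n d X Y f hX hXc hY hYc hf x₀ hx₀
        rw [max_eq_right (by linarith : 4 * θ - 2 ≤ 0), zero_add]
        exact h.exists_isGameStationary_of_le_half hθ hθ2 hτ hY hXD hYD hKL.2 hx₀ hy₀
    · refine ⟨scheduledParams L (1 / 10 ^ 10) (1 / (2 * θ)), 2 * L + 1 / L + 1, fun T hT => ?_,
        fun n d X Y f hX hXc hY hYc hXD hYD hf hKL x₀ hx₀ y₀ hy₀ => ?_⟩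
      · have := scheduledParams_admissible (γ := 1 / (2 * θ)) hL (by norm_num) le_rfl
          (by rw [div_le_one (by linarith)]; linarith) hT
        rw [max_eq_left (by linarith)]
        rwa [show 1 / (2 * θ) - 1 = -((2 * θ - 1) / (2 * θ)) by field_simp; ring] at this
      · have h := problem n d X Y f hX hXc hY hYc hf x₀ hx₀
        have := h.exists_isGameStationary_of_half_lt hθ2 (by positivity) hKL.2 hx₀ hy₀
        rw [max_eq_left (by linarith : 0 ≤ 4 * θ - 2)]
        rwa [show -(1 / (2 * θ) / 2) = -(1 / (4 * θ - 2 + 2)) by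
          rw [sub_add_cancel, div_div]; ring_nf] at this
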